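/- **Terms.** Terms are built from the singleton $1$ by concatenations $s\,^\wedge t$ and shuffles $\mathbb{Q}_n(t_0,\dots,t_{n-1})$ with $n\ge 1$. Concatenations are written without brackets, and the order in which the terms of a shuffle are listed is disregarded; $=$ between terms means equality up to these two conventions. A term $t$ represents a linear order $L_t$: $L_1$ is a point, $L_{s^\wedge t}$ is $L_s$ followed by $L_t$, and $L_{\mathbb{Q}_n(t_0,\dots,t_{n-1})}$ is obtained from the countable dense linear order without endpoints, coloured with $n$ interdense colours, by replacing each point of colour $i$ by a copy of $L_{t_i}$. A term is *finite* if $L_t$ is finite. **Normal form of terms.** Every finite term is in normal form. A shuffle $\mathbb{Q}_n(t_0,\dots,t_{n-1})$ is in normal form if - all $t_i$ are in normal form; - $t_i\neq t_j$ for $i\ne j$; - there are no terms $p_0,\dots,p_{k-1}$ ($k\ge1$) such that every $t_i$ either is one of the $p_j$ or has the form $\tau_0\,^\wedge\,\mathbb{Q}_k(p_0,\dots,p_{k-1})\,^\wedge\,\tau_1$ with $\tau_0,\tau_1\in\{\emptyset,p_0,\dots,p_{k-1}\}$, and at least one $t_i$ has the latter form. A concatenation of singletons and shuffles is in normal form if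 each of these components is, and no block of consecutive components has the form $$\mathbb{Q}_k(p_0,\dots,p_{k-1})\,^\wedge\,\tau\,^\wedge\,\mathbb{Q}_k(p_0,\dots,p_{k-1}),\qquad \tau\in\{\emptyset,p_0,\dots,p_{k-1}\},\qquad(*)$$ where $\tau$ may consist of several components. **Normal form of sequences.** A finite sequence of terms $(s_i)$, or an infinite one of order type $\omega$, is in normal form if - each $s_i$ is a finite term or a shuffle, and is in normal form; - no block $s_i\,^\wedge\cdots\,^\wedge s_k$ of consecutive entries has the form $(*)$, where the first and last entries of the block are the two copies of $\mathbb{Q}_k(p_0,\dots,p_{k-1})$ and $\tau$ is the concatenation of the entries between them; - if $s_j$ is finite and is not the last term of the sequence, then either $s_{j+1}$ is infinite, or the sequence is infinite and $s_k=1$ for all $k\ge j$. **Proposition.** Let $(T_i)$ and $(S_i)$ be sequences in normal form, each finite or of order type $\omega$. If the linear orders $L_{T_0}\,^\wedge L_{T_1}\,^\wedge\cdots$ and $L_{S_0}\,^\wedge L_{S_1}\,^\wedge\cdots$ encoded by their concatenations are isomorphic, then the two sequences have the same length and $T_j=S_j$ for all $j$. -/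

import Mathlib

/-- A colouring of a linear order by `κ` whose colours occur interdensely: every colour occurs
between any two points. -/
def Interdense {Q κ : Type*} [LinearOrder Q] (c : Q → κ) : Prop :=
  ∀ x y : Q, x < y → ∀ i : κ, ∃ z : Q, x < z ∧ z < y ∧ c z = i

/-- A concrete model of the generic countable dense linear order without endpoints with the
`n + 1` interdense colours `0, …, n`: the underlying order is `ℚ`, and a rational number is
coloured by the exponent of `2` in its denominator, modulo `n + 1`. -/
def genericColour (n : ℕ) (q : ℚ) : Fin (n + 1) :=
  Fin.ofNat (n + 1) (padicValNat 2 q.den)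

theorem genericColour_interdense (n : ℕ) : Interdense (genericColour n) := by
  intro x y hxy i
  obtain ⟨N, hN⟩ := exists_nat_gt (2 / (y - x))
  have hd : 0 < y - x := sub_pos.2 hxy
  have hN0 : (2 : ℚ) < N * (y - x) := by rwa [div_lt_iff₀ hd] at hN
  set k : ℕ := (i : ℕ) + (n + 1) * (N + 1) with hk
  have hk1 : N ≤ k := by nlinarith
  have hk0 : k ≠ 0 := by
    have : 0 < (n + 1) * (N + 1) := by positivity
    omega
  have hNk : (N : ℚ) ≤ 2 ^ k := by
    have : N ≤ 2 ^ k := hk1.trans Nat.lt_two_pow_self.le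
    exact_mod_cast this
  have h2 : (2 : ℚ) < 2 ^ k * (y - x) := by nlinarith
  have hp : (0 : ℚ) < 2 ^ k := by positivity
  -- an odd integer strictly between `2 ^ k * x` and `2 ^ k * y`
  obtain ⟨a, ha, hxa, hay⟩ : ∃ a : ℤ, Odd a ∧ 2 ^ k * x < a ∧ (a : ℚ) < 2 ^ k * y := by
    have h3 := Int.lt_floor_add_one (2 ^ k * x)
    have h4 := Int.floor_le (2 ^ k * x)
    rcases Int.even_or_odd (⌊2 ^ k * x⌋ + 1) with he | ho
    · refine ⟨⌊2 ^ k * x⌋ + 1 + 1, he.add_one, ?_, ?_⟩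
      · push_cast; linarith
      · push_cast; linarith
    · refine ⟨⌊2 ^ k * x⌋ + 1, ho, ?_, ?_⟩
      · push_cast; linarith
      · push_cast; linarith
  refine ⟨(a : ℚ) / 2 ^ k, by rw [lt_div_iff₀ hp]; linarith, by rw [div_lt_iff₀ hp]; linarith, ?_⟩
  have hcop : Nat.Coprime a.natAbs (2 ^ k : ℕ) := by
    apply Nat.Coprime.pow_right
    exact (Nat.coprime_two_right).2 (Int.natAbs_odd.2 ha)
  have hden : ((a : ℚ) / 2 ^ k).den = 2 ^ k := by
    have h := Rat.den_div_eq_of_coprime (a := a) (b := 2 ^ k) (by positivity)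
      (by simpa [Int.natAbs_pow] using hcop)
    push_cast at h
    exact_mod_cast h
  apply Fin.ext
  have hi := i.isLt
  simp only [genericColour, hden, padicValNat.prime_pow, Fin.ofNat]
  rw [hk, Nat.add_mul_mod_self_left, Nat.mod_eq_of_lt hi]

/-- Terms: the singleton, binary concatenations, and shuffles `ℚ_{n+1}(t 0, …, t n)` of a
nonempty finite family of terms. -/
inductive OTerm : Type
  | one : OTerm
  | concat (s t : OTerm) : OTerm
  | shuffle (n : ℕ) (t : Fin (n + 1) → OTerm) : OTerm

namespace OTerm

/-- The linear order `L_t` represented by the term `t`. -/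
noncomputable def toLinOrd : OTerm → LinOrd.{0}
  | one => LinOrd.of Unit
  | concat s t => LinOrd.of (s.toLinOrd ⊕ₗ t.toLinOrd)
  | shuffle n t => LinOrd.of (Σₗ q : ℚ, (t (genericColour n q)).toLinOrd)

/-- A term is finite if it represents a finite linear order. -/
def IsFinite (t : OTerm) : Prop := Finite t.toLinOrd

/-- A term is a shuffle. -/
def IsShuffle (t : OTerm) : Prop := ∃ n p, t = shuffle n p

/-- Equality of terms, written without brackets in concatenations and without an order on the
list of terms that are shuffled: the congruence generated by associativity of concatenation and
permutation of the arguments of a shuffle. It does not refer to the represented orders. -/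
inductive Same : OTerm → OTerm → Prop
  | refl (t : OTerm) : Same t t
  | symm {s t : OTerm} : Same s t → Same t s
  | trans {s t u : OTerm} : Same s t → Same t u → Same s u
  | assoc (s t u : OTerm) : Same (concat (concat s t) u) (concat s (concat t u))
  | concat {s s' t t' : OTerm} : Same s s' → Same t t' → Same (concat s t) (concat s' t')
  | shuffle {n m : ℕ} {s : Fin (n + 1) → OTerm} {t : Fin (m + 1) → OTerm}
      (e : Fin (n + 1) ≃ Fin (m + 1)) :
      (∀ i, Same (s i) (t (e i))) → Same (shuffle n s) (shuffle m t)

/-- `IsConcat [a₀, …, aₖ] t`: the list is nonempty and `t` is the term `a₀ ^ … ^ aₖ`. -/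
def IsConcat : List OTerm → OTerm → Prop
  | [], _ => False
  | a :: l, t => Same (l.foldl concat a) t

/-- The components of a term written without brackets as a concatenation of singletons and
shuffles. -/
def atoms : OTerm → List OTerm
  | one => [one]
  | concat s t => s.atoms ++ t.atoms
  | shuffle n t => [shuffle n t]

/-- The shuffle of `t` has a repeated argument. -/
def HasRepeat {n : ℕ} (t : Fin (n + 1) → OTerm) : Prop :=
  ∃ i j, i ≠ j ∧ Same (t i) (t j)

/-- `s` is `τ₀ ^ ℚ(p) ^ τ₁` with each of `τ₀`, `τ₁` either empty or one of the terms `p j`. -/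
def IsFlanked {k : ℕ} (p : Fin (k + 1) → OTerm) (s : OTerm) : Prop :=
  ∃ τ₀ τ₁ : Option (Fin (k + 1)),
    IsConcat ((τ₀.map p).toList ++ [shuffle k p] ++ (τ₁.map p).toList) s

/-- The shuffle of `t` collapses to a shuffle `ℚ(p)` that occurs in its arguments: at least one
argument is `τ₀ ^ ℚ(p) ^ τ₁`, and every argument is either of this kind or one of the terms
`p j`. -/
def HasNesting {n : ℕ} (t : Fin (n + 1) → OTerm) : Prop :=
  ∃ (k : ℕ) (p : Fin (k + 1) → OTerm),
    (∃ i, IsFlanked p (t i)) ∧ ∀ i, IsFlanked p (t i) ∨ ∃ j, Same (t i) (p j)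

/-- The list of terms is `ℚ(p), m₁, …, mᵣ, ℚ(p)` where either `r = 0` or `m₁ ^ … ^ mᵣ` is one of
the terms `p i`. -/
def IsAbsorbing (l : List OTerm) : Prop :=
  ∃ (n : ℕ) (p : Fin (n + 1) → OTerm) (m : List OTerm) (P : OTerm),
    l = shuffle n p :: (m ++ [P]) ∧ Same (shuffle n p) P ∧ (m = [] ∨ ∃ i, IsConcat m (p i))

/-- Terms in normal form. (A finite term is a concatenation of singletons, so it is always in
normal form.) -/
def IsNormal : OTerm → Prop
  | one => True
  | concat s t => s.IsNormal ∧ t.IsNormal ∧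
      ∀ l : List OTerm, l <:+: (concat s t).atoms → ¬ IsAbsorbing l
  | shuffle _ t => (∀ i, (t i).IsNormal) ∧ ¬ HasRepeat t ∧ ¬ HasNesting t

end OTerm

/-- A finite sequence of terms, or an infinite one of order type `ω`. -/
structure TermSeq where
  /-- the length, `⊤` for an infinite sequence -/
  length : ℕ∞
  /-- the terms of the sequence -/
  term : {i : ℕ // (i : ℕ∞) < length} → OTerm

namespace TermSeq

/-- The linear order encoded by the concatenation of the sequence. -/
abbrev order (T : TermSeq) : Type :=
  Σₗ i : {i : ℕ // (i : ℕ∞) < T.length}, (T.term i).toLinOrd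

/-- The list `l` is the segment of the sequence that starts at index `i`. -/
def IsSegment (T : TermSeq) (i : ℕ) (l : List OTerm) : Prop :=
  ∀ (m : ℕ) (hm : m < l.length), ∃ h : ((i + m : ℕ) : ℕ∞) < T.length, T.term ⟨i + m, h⟩ = l[m]

/-- Sequences in normal form. -/
structure IsNormal (T : TermSeq) : Prop where
  /-- each component is a finite term or a shuffle -/
  component : ∀ i, (T.term i).IsFinite ∨ (T.term i).IsShuffle
  /-- each component is in normal form -/
  normal : ∀ i, (T.term i).IsNormal
  /-- no segment `ℚ(p), m₁, …, mᵣ, ℚ(p)` can be absorbed into `ℚ(p)` -/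
  not_absorbing : ∀ (i : ℕ) (l : List OTerm), T.IsSegment i l → ¬ OTerm.IsAbsorbing l
  /-- a finite component is followed by an infinite one, unless the sequence is infinite and
  constantly `1` from there on -/
  finite_next : ∀ (j : ℕ) (hj : (j : ℕ∞) < T.length) (hj' : ((j + 1 : ℕ) : ℕ∞) < T.length),
    (T.term ⟨j, hj⟩).IsFinite →
      ¬ (T.term ⟨j + 1, hj'⟩).IsFinite ∨
        (T.length = ⊤ ∧ ∀ (k : ℕ) (hk : (k : ℕ∞) < T.length), j ≤ k → T.term ⟨k, hk⟩ = OTerm.one)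

end TermSeq

/-! A shuffle is self-similar. By the coloured form of Cantor's theorem an open interval of its
blocks is the whole shuffle again, so it embeds convexly in each of its nonempty initial and final
segments. Call ℚ(p) tight if it does not embed convexly in any p_i. A convex copy of a tight ℚ(p) in
itself cannot end inside a block: an end piece would lie in that block and contain yet another copy.
So the copy is an open interval of blocks. Hence a shuffle that embeds in ℚ(p) and conversely is
isomorphic to it (`Tight.of_convexEmb`). An isomorphism onto ℚ(p) maps each block to a block, or to
a copy of ℚ(p) with at most one block on either side (`Shuffle.block_cases`). Between two copies of
ℚ(p) inside ℚ(p) lies nothing, a single block, or a set containing a further copy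
(`Shuffle.between_cases`).

Take a sequence of finite terms and tight shuffles without absorbing segments. A leading ℚ(p) is a
maximal initial segment of its isomorphism type (`IsGood.eq_fibre`): a larger one would contain a
copy of ℚ(p) in some later component. The first such component is isomorphic to ℚ(p), and the
entries before it form nothing or a single p_i, which is an absorbing segment. So isomorphisms match
leading shuffles. A leading finite term is matched because what follows it has no least point,
unless all entries are singletons. Removing the first entries and repeating gives
`IsReduced.unique`.

It remains that normal shuffles are tight and that isomorphic normal terms are the same. Tightness
up to rank N yields uniqueness up to rank N, by induction on total size with the sequence argument
applied to lists of atoms (`uniqueBelow_of_tightUpTo`). For rank N + 1, if ℚ(p) embedded in some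
p_i, it would be isomorphic to a shuffle ℚ(q) occurring in that p_i. Then every argument of ℚ(p)
would be some q_j or a flanked ℚ(q), which is the nesting that normal form excludes
(`tightUpTo_succ`). -/

open Set

/-! ### Convex embeddings and decompositions of linear orders -/

/-- `A` is isomorphic to a convex subset of `B`. -/
def ConvexEmb (A B : Type*) [LinearOrder A] [LinearOrder B] : Prop :=
  ∃ f : A ↪o B, (range f).OrdConnected

namespace ConvexEmb

variable {A B C : Type*} [LinearOrder A] [LinearOrder B] [LinearOrder C]

theorem of_iso (e : A ≃o B) : ConvexEmb A B :=
  ⟨e.toOrderEmbedding, by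
    have : range e.toOrderEmbedding = univ := e.surjective.range_eq
    rw [this]; exact ordConnected_univ⟩

theorem trans : ConvexEmb A B → ConvexEmb B C → ConvexEmb A C := by
  rintro ⟨f, hf⟩ ⟨g, hg⟩
  refine ⟨f.trans g, ⟨?_⟩⟩
  rintro _ ⟨x, rfl⟩ _ ⟨y, rfl⟩ z ⟨hxz, hzy⟩
  obtain ⟨w, rfl⟩ := hg.out ⟨f x, rfl⟩ ⟨f y, rfl⟩ ⟨hxz, hzy⟩
  obtain ⟨v, rfl⟩ := hf.out ⟨x, rfl⟩ ⟨y, rfl⟩ ⟨g.le_iff_le.1 hxz, g.le_iff_le.1 hzy⟩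
  exact ⟨v, rfl⟩

theorem congr_left (e : A ≃o B) (h : ConvexEmb A C) : ConvexEmb B C := (of_iso e.symm).trans h

theorem congr_right (e : B ≃o C) (h : ConvexEmb A B) : ConvexEmb A C := h.trans (of_iso e)

theorem of_subset {S T : Set A} (hST : S ⊆ T) (hS : S.OrdConnected) : ConvexEmb S T := by
  refine ⟨⟨⟨inclusion hST, inclusion_injective hST⟩, Iff.rfl⟩, ⟨?_⟩⟩
  rintro _ ⟨x, rfl⟩ _ ⟨y, rfl⟩ z ⟨hxz, hzy⟩
  exact ⟨⟨z, hS.out x.2 y.2 ⟨hxz, hzy⟩⟩, rfl⟩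

theorem of_set {S : Set A} (hS : S.OrdConnected) : ConvexEmb S A := by
  refine ⟨OrderEmbedding.subtype _, ?_⟩
  simpa using hS

theorem exists_set (h : ConvexEmb A B) :
    ∃ S : Set B, S.OrdConnected ∧ Nonempty (A ≃o S) := by
  obtain ⟨f, hf⟩ := h
  exact ⟨range f, hf, ⟨f.orderIso⟩⟩

end ConvexEmb

/-- The image of a subset of `S` under an isomorphism between `S` and `B`. -/
theorem exists_orderIso_image {A B : Type*} [LinearOrder A] [LinearOrder B] (e : A ≃o B)
    (S : Set A) : Nonempty (S ≃o e '' S) :=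
  ⟨{ e.toEquiv.image S with map_rel_iff' := by intro a b; exact e.le_iff_le }⟩

/-- A linear order is determined by the fibres of a monotone map. -/
theorem orderIso_of_fibres {X Y ι κ : Type*} [LinearOrder X] [LinearOrder Y] [LinearOrder ι]
    [LinearOrder κ] {f : X → ι} {g : Y → κ} (hf : Monotone f) (hg : Monotone g) (e : ι ≃o κ)
    (h : ∀ i, Nonempty (f ⁻¹' {i} ≃o g ⁻¹' {e i})) : Nonempty (X ≃o Y) := by
  let φ' : ∀ i, f ⁻¹' {i} ≃o g ⁻¹' {e i} := fun i => (h i).some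
  let F : X → Y := fun x => (φ' (f x) ⟨x, rfl⟩ : Y)
  have hF : ∀ i (x : X) (hx : f x = i), F x = φ' i ⟨x, hx⟩ := by
    rintro i x rfl; rfl
  have hgF : ∀ x, g (F x) = e (f x) := fun x => (φ' (f x) ⟨x, rfl⟩).2
  have hmono : StrictMono F := by
    intro x y hxy
    rcases (hf hxy.le).lt_or_eq with h1 | h1
    · by_contra hlt
      have := hg (not_lt.1 hlt)
      rw [hgF, hgF] at this
      exact absurd h1 (not_lt.2 (e.le_iff_le.1 this))
    · rw [hF (f y) x h1, hF (f y) y rfl]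
      exact (φ' (f y)).lt_iff_lt.2 hxy
  have hsurj : Function.Surjective F := by
    intro y
    obtain ⟨i, hi⟩ := e.surjective (g y)
    obtain ⟨⟨x, hx⟩, hxy⟩ := (φ' i).surjective ⟨y, hi.symm⟩
    exact ⟨x, by rw [hF i x hx, hxy]⟩
  exact ⟨hmono.orderIsoOfSurjective F hsurj⟩

/-- The union of two sets, one before the other, is their ordered sum. -/
theorem orderIso_union {X : Type*} [LinearOrder X] {S T : Set X}
    (h : ∀ x ∈ S, ∀ y ∈ T, x < y) : Nonempty (↥(S ∪ T) ≃o S ⊕ₗ T) := by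
  let F : S ⊕ₗ T → ↥(S ∪ T) := fun z =>
    Sum.elim (fun x => ⟨x.1, Or.inl x.2⟩) (fun y => ⟨y.1, Or.inr y.2⟩) (ofLex z)
  have hmono : StrictMono F := by
    rintro (x | x) (y | y) hxy
    · have := Sum.Lex.inl_lt_inl_iff.1 hxy
      exact this
    · exact h _ x.2 _ y.2
    · exact absurd hxy Sum.Lex.not_inr_lt_inl
    · have := Sum.Lex.inr_lt_inr_iff.1 hxy
      exact this
  have hsurj : Function.Surjective F := by
    rintro ⟨x, hx | hx⟩
    · exact ⟨toLex (Sum.inl ⟨x, hx⟩), rfl⟩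
    · exact ⟨toLex (Sum.inr ⟨x, hx⟩), rfl⟩
  exact ⟨(hmono.orderIsoOfSurjective F hsurj).symm⟩

theorem orderIso_setCongr {X : Type*} [LinearOrder X] {S T : Set X} (h : S = T) :
    Nonempty (S ≃o T) := by subst h; exact ⟨OrderIso.refl _⟩

theorem orderIso_preimage_val {X : Type*} [LinearOrder X] {S T : Set X} (h : T ⊆ S) :
    Nonempty ((Subtype.val ⁻¹' T : Set S) ≃o T) :=
  ⟨⟨⟨fun x => ⟨x.1.1, x.2⟩, fun x => ⟨⟨x.1, h x.2⟩, x.2⟩, fun _ => rfl, fun _ => rfl⟩, Iff.rfl⟩⟩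

/-- The preimage of a subset under an isomorphism with a larger subset. -/
theorem orderIso_preimage {A X : Type*} [LinearOrder A] [LinearOrder X] {S T : Set X}
    (e : A ≃o S) (h : T ⊆ S) : Nonempty ({a | (e a : X) ∈ T} ≃o T) := by
  obtain ⟨φ⟩ := exists_orderIso_image e {a | (e a : X) ∈ T}
  have : e '' {a | (e a : X) ∈ T} = Subtype.val ⁻¹' T :=
    image_preimage_eq (Subtype.val ⁻¹' T) e.surjective
  rw [this] at φ
  exact ⟨φ.trans (orderIso_preimage_val h).some⟩

/-! ### Lexicographic sums and their blocks -/

section Sigma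

variable {ι : Type*} {A : ι → Type*}

/-- The index of the summand that contains a point of a lexicographic sum. -/
def lexFst (x : Σₗ i, A i) : ι := (ofLex x).1

theorem exists_lexFst_eq [h : ∀ i, Nonempty (A i)] (i : ι) : ∃ x : Σₗ i, A i, lexFst x = i :=
  ⟨toLex ⟨i, (h i).some⟩, rfl⟩

variable [LinearOrder ι] [∀ i, LinearOrder (A i)]

theorem lexFst_monotone : Monotone (lexFst : (Σₗ i, A i) → ι) := by
  intro x y h
  rcases Sigma.Lex.le_def.1 h with h | ⟨h, -⟩
  · exact h.le
  · exact h.le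

theorem lt_of_lexFst_lt {x y : Σₗ i, A i} (h : lexFst x < lexFst y) : x < y :=
  lt_of_not_ge fun h' => not_lt.2 (lexFst_monotone h') h

theorem lexFst_fibre (i : ι) : Nonempty (A i ≃o (lexFst ⁻¹' {i} : Set (Σₗ i, A i))) := by
  let F : A i → (lexFst ⁻¹' {i} : Set (Σₗ i, A i)) := fun a => ⟨toLex ⟨i, a⟩, rfl⟩
  have hmono : StrictMono F := fun a b h => Sigma.Lex.right a b h
  refine ⟨hmono.orderIsoOfSurjective F ?_⟩
  rintro ⟨⟨j, a⟩, rfl⟩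
  exact ⟨a, rfl⟩

theorem ordConnected_lexFst_preimage {U : Set ι} (hU : U.OrdConnected) :
    (lexFst ⁻¹' U : Set (Σₗ i, A i)).OrdConnected :=
  hU.preimage_mono lexFst_monotone

end Sigma

/-! ### Cantor's theorem for interdense colourings -/

section Cantor

open Order

variable {α β κ : Type*} [LinearOrder α] [LinearOrder β]

/-- Finite partial isomorphisms that respect two colourings. -/
def ColourIso (c : α → κ) (d : β → κ) : Type _ :=
  {f : PartialIso α β // ∀ p ∈ f.1, d p.2 = c p.1}

instance (c : α → κ) (d : β → κ) : Preorder (ColourIso c d) :=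
  inferInstanceAs (Preorder {f : PartialIso α β // ∀ p ∈ f.1, d p.2 = c p.1})

theorem Interdense.exists_between_finsets [NoMinOrder α] [NoMaxOrder α] [Nonempty α] {c : α → κ}
    (hc : Interdense c) (lo hi : Finset α) (h : ∀ x ∈ lo, ∀ y ∈ hi, x < y) (i : κ) :
    ∃ m, (∀ x ∈ lo, x < m) ∧ (∀ y ∈ hi, m < y) ∧ c m = i := by
  have : DenselyOrdered α := ⟨fun x y hxy => by
    obtain ⟨z, h1, h2, -⟩ := hc x y hxy i
    exact ⟨z, h1, h2⟩⟩
  -- Density gives two points of the gap; interdensity then finds the colour between them.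
  obtain ⟨m, hm1, hm2⟩ := Order.exists_between_finsets lo hi h
  obtain ⟨m', hm1', hm2'⟩ := Order.exists_between_finsets (insert m lo) hi (by
    intro x hx y hy
    rcases Finset.mem_insert.1 hx with rfl | hx
    · exact hm2 y hy
    · exact h x hx y hy)
  obtain ⟨z, h1, h2, h3⟩ := hc m m' (hm1' m (Finset.mem_insert_self _ _)) i
  exact ⟨z, fun x hx => (hm1 x hx).trans h1, fun y hy => h2.trans (hm2' y hy), h3⟩

/-- The forth step: a new point must go to the gap between the images of the smaller and of the
larger points, and interdensity meets this gap in the required colour. -/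
theorem ColourIso.exists_across [NoMinOrder β] [NoMaxOrder β] [Nonempty β] {c : α → κ} {d : β → κ}
    (hd : Interdense d) (f : ColourIso c d) (a : α) :
    ∃ b : β, d b = c a ∧ ∀ p ∈ f.1.1, cmp p.1 a = cmp p.2 b := by
  by_cases h : ∃ b, (a, b) ∈ f.1.1
  · obtain ⟨b, hb⟩ := h
    exact ⟨b, f.2 _ hb, fun p hp => f.1.2 _ hp _ hb⟩
  obtain ⟨b, hb1, hb2, hb⟩ := hd.exists_between_finsets
    ({p ∈ f.1.1 | p.1 < a}.image Prod.snd) ({p ∈ f.1.1 | a < p.1}.image Prod.snd) (by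
      intro x hx y hy
      obtain ⟨p, hp, rfl⟩ := Finset.mem_image.1 hx
      obtain ⟨q, hq, rfl⟩ := Finset.mem_image.1 hy
      rw [Finset.mem_filter] at hp hq
      rw [← lt_iff_lt_of_cmp_eq_cmp (f.1.2 _ hp.1 _ hq.1)]
      exact hp.2.trans hq.2) (c a)
  refine ⟨b, hb, fun p hp => ?_⟩
  rcases lt_trichotomy p.1 a with hl | rfl | hr
  · rw [(cmp_eq_lt_iff _ _).2 hl, (cmp_eq_lt_iff _ _).2
      (hb1 _ (Finset.mem_image_of_mem _ (Finset.mem_filter.2 ⟨hp, hl⟩)))]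
  · exact absurd ⟨p.2, hp⟩ h
  · rw [(cmp_eq_gt_iff _ _).2 hr, (cmp_eq_gt_iff _ _).2
      (hb2 _ (Finset.mem_image_of_mem _ (Finset.mem_filter.2 ⟨hp, hr⟩)))]

theorem ColourIso.exists_insert {c : α → κ} {d : β → κ} (f : ColourIso c d) {a : α} {b : β}
    (hab : d b = c a) (h : ∀ p ∈ f.1.1, cmp p.1 a = cmp p.2 b) :
    ∃ g, f ≤ g ∧ (a, b) ∈ g.1.1 := by
  classical
  refine ⟨⟨⟨insert (a, b) f.1.1, fun p hp q hq => ?_⟩, fun p hp => ?_⟩,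
    Finset.subset_insert _ _, Finset.mem_insert_self _ _⟩
  · rw [Finset.mem_insert] at hp hq
    rcases hp with (rfl | pf) <;> rcases hq with (rfl | qf)
    · simp only [cmp_self_eq_eq]
    · rw [cmp_eq_cmp_symm]
      exact h _ qf
    · exact h _ pf
    · exact f.1.2 _ pf _ qf
  · rcases Finset.mem_insert.1 hp with rfl | hp
    · exact hab
    · exact f.2 p hp

/-- Countable linear orders without endpoints with interdense colours are isomorphic. -/
theorem exists_orderIso_of_interdense [Countable α] [NoMinOrder α] [NoMaxOrder α] [Nonempty α]
    [Countable β] [NoMinOrder β] [NoMaxOrder β] [Nonempty β] {c : α → κ} {d : β → κ}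
    (hc : Interdense c) (hd : Interdense d) : ∃ e : α ≃o β, ∀ a, d (e a) = c a := by
  cases nonempty_encodable α
  cases nonempty_encodable β
  let L : α → Cofinal (ColourIso c d) := fun a =>
    { carrier := {f | ∃ b, (a, b) ∈ f.1.1}
      isCofinal := fun f => by
        obtain ⟨b, hb, h⟩ := f.exists_across hd a
        obtain ⟨g, hg, hab⟩ := f.exists_insert hb h
        exact ⟨g, ⟨b, hab⟩, hg⟩ }
  let R : β → Cofinal (ColourIso c d) := fun b =>
    { carrier := {f | ∃ a, (a, b) ∈ f.1.1}
      isCofinal := fun f => by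
        -- The back step is the forth step for the inverse partial isomorphism.
        let f' : ColourIso d c := ⟨⟨f.1.1.image Prod.swap, by
          intro p hp q hq
          obtain ⟨p', hp', rfl⟩ := Finset.mem_image.1 hp
          obtain ⟨q', hq', rfl⟩ := Finset.mem_image.1 hq
          exact (f.1.2 p' hp' q' hq').symm⟩, by
          intro p hp
          obtain ⟨q, hq, rfl⟩ := Finset.mem_image.1 hp
          exact (f.2 q hq).symm⟩
        obtain ⟨a, ha, h⟩ := f'.exists_across hc b
        obtain ⟨g, hg, hab⟩ := f.exists_insert ha.symm fun p hp =>
          (h p.swap (Finset.mem_image_of_mem _ hp)).symm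
        exact ⟨g, ⟨a, hab⟩, hg⟩ }
  let D : α ⊕ β → Cofinal (ColourIso c d) := Sum.elim L R
  let e0 : ColourIso c d := ⟨⟨∅, fun p hp => absurd hp (Finset.notMem_empty p)⟩,
    fun p hp => absurd hp (Finset.notMem_empty p)⟩
  -- The ideal meets each of the countably many cofinal sets in `D`, so its members together are
  -- defined on all of `α` and reach all of `β`.
  let I : Ideal (ColourIso c d) := idealOfCofinals e0 D
  have hL : ∀ a, ∃ b, ∃ f ∈ I, (a, b) ∈ f.1.1 := fun a => by
    obtain ⟨f, ⟨b, hb⟩, hf⟩ := cofinal_meets_idealOfCofinals e0 D (Sum.inl a)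
    exact ⟨b, f, hf, hb⟩
  have hR : ∀ b, ∃ a, ∃ f ∈ I, (a, b) ∈ f.1.1 := fun b => by
    obtain ⟨f, ⟨a, ha⟩, hf⟩ := cofinal_meets_idealOfCofinals e0 D (Sum.inr b)
    exact ⟨a, f, hf, ha⟩
  choose F hF using hL
  choose G hG using hR
  refine ⟨OrderIso.ofCmpEqCmp F G fun a b => ?_, fun a => ?_⟩
  · obtain ⟨f, hf, ha⟩ := hF a
    obtain ⟨g, hg, hb⟩ := hG b
    obtain ⟨m, -, fm, gm⟩ := I.directed _ hf _ hg
    exact m.1.2 (a, _) (fm ha) (_, b) (gm hb)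
  · obtain ⟨f, -, ha⟩ := hF a
    exact f.2 _ ha

end Cantor

/-! ### Shuffles of linear orders -/

/-- The shuffle of the linear orders `A 0, …, A n`. -/
abbrev Shuffle {n : ℕ} (A : Fin (n + 1) → Type) : Type := Σₗ q : ℚ, A (genericColour n q)

namespace Shuffle

variable {n : ℕ} {A : Fin (n + 1) → Type} [∀ i, LinearOrder (A i)]

theorem exists_colour_between (n : ℕ) {x y : ℚ} (h : x < y) (i : Fin (n + 1)) :
    ∃ z, x < z ∧ z < y ∧ genericColour n z = i := genericColour_interdense n x y h i

theorem exists_colour (n : ℕ) (i : Fin (n + 1)) : ∃ z, genericColour n z = i := by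
  obtain ⟨z, -, -, h⟩ := exists_colour_between n (zero_lt_one) i
  exact ⟨z, h⟩

theorem colour_convexEmb (A : Fin (n + 1) → Type) [∀ i, LinearOrder (A i)] (i : Fin (n + 1)) :
    ConvexEmb (A i) (Shuffle A) := by
  obtain ⟨q, rfl⟩ := exists_colour n i
  exact (ConvexEmb.of_set (ordConnected_lexFst_preimage ordConnected_singleton)).congr_left
    (lexFst_fibre (A := fun q => A (genericColour n q)) q).some.symm

/-- A convex set of blocks of a shuffle that has neither a first nor a last block. -/
structure IsOpenInterval (U : Set ℚ) : Prop where
  nonempty : U.Nonempty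
  ordConnected : U.OrdConnected
  exists_lt : ∀ u ∈ U, ∃ v ∈ U, v < u
  exists_gt : ∀ u ∈ U, ∃ v ∈ U, u < v

theorem isOpenInterval_Iio (q : ℚ) : IsOpenInterval (Iio q) :=
  ⟨⟨q - 1, sub_one_lt q⟩, ordConnected_Iio,
    fun u hu => ⟨u - 1, (sub_one_lt u).trans hu, sub_one_lt u⟩,
    fun _ hu => (exists_between hu).imp fun _ h => ⟨h.2, h.1⟩⟩

theorem isOpenInterval_Ioi (q : ℚ) : IsOpenInterval (Ioi q) :=
  ⟨⟨q + 1, lt_add_one q⟩, ordConnected_Ioi,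
    fun _ hu => (exists_between hu).imp fun _ h => ⟨h.1, h.2⟩,
    fun u hu => ⟨u + 1, lt_trans hu (lt_add_one u), lt_add_one u⟩⟩

theorem isOpenInterval_Ioo {a b : ℚ} (h : a < b) : IsOpenInterval (Ioo a b) :=
  ⟨nonempty_Ioo.2 h, ordConnected_Ioo,
    fun _ hu => (exists_between hu.1).imp fun _ h => ⟨⟨h.1, h.2.trans hu.2⟩, h.2⟩,
    fun _ hu => (exists_between hu.2).imp fun _ h => ⟨⟨hu.1.trans h.1, h.2⟩, h.1⟩⟩

/-- An open interval of blocks of a shuffle is isomorphic to the whole shuffle. -/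
theorem orderIso_of_isOpenInterval {U : Set ℚ} (hU : IsOpenInterval U) :
    Nonempty (Shuffle A ≃o (lexFst ⁻¹' U : Set (Shuffle A))) := by
  have : Nonempty U := hU.nonempty.to_subtype
  have : NoMinOrder U := ⟨fun u => by
    obtain ⟨v, hv, h⟩ := hU.exists_lt u u.2
    exact ⟨⟨v, hv⟩, h⟩⟩
  have : NoMaxOrder U := ⟨fun u => by
    obtain ⟨v, hv, h⟩ := hU.exists_gt u u.2
    exact ⟨⟨v, hv⟩, h⟩⟩
  have hint : Interdense (fun u : U => genericColour n u) := fun x y hxy i => by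
    obtain ⟨z, h1, h2, h3⟩ := genericColour_interdense n x y hxy i
    exact ⟨⟨z, hU.ordConnected.out x.2 y.2 ⟨h1.le, h2.le⟩⟩, h1, h2, h3⟩
  -- Cantor's theorem matches `ℚ` with `U` respecting colours, so corresponding blocks are copies of
  -- the same order.
  obtain ⟨e, he⟩ := exists_orderIso_of_interdense (genericColour_interdense n) hint
  let g : (lexFst ⁻¹' U : Set (Shuffle A)) → U := fun x => ⟨lexFst x.1, x.2⟩
  refine orderIso_of_fibres (lexFst_monotone) (g := g)
    (fun x y h => lexFst_monotone (A := fun q => A (genericColour n q)) h) e fun q => ?_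
  obtain ⟨φ⟩ := lexFst_fibre (A := fun q => A (genericColour n q)) q
  obtain ⟨ψ⟩ := lexFst_fibre (A := fun q => A (genericColour n q)) (e q : ℚ)
  have hψ : Nonempty ((lexFst ⁻¹' {(e q : ℚ)} : Set (Shuffle A)) ≃o g ⁻¹' {e q}) := by
    refine ⟨⟨⟨fun x => ⟨⟨x.1, ?_⟩, ?_⟩, fun x => ⟨x.1.1, ?_⟩, fun x => rfl, fun x => rfl⟩, Iff.rfl⟩⟩
    · have h : lexFst x.1 = (e q : ℚ) := x.2
      change lexFst x.1 ∈ U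
      rw [h]; exact (e q).2
    · exact Subtype.ext x.2
    · exact congrArg Subtype.val x.2
  have hcol : genericColour n (e q : ℚ) = genericColour n q := he q
  have : Nonempty (A (genericColour n q) ≃o A (genericColour n (e q : ℚ))) := by
    rw [hcol]; exact ⟨OrderIso.refl _⟩
  exact ⟨((φ.symm.trans this.some).trans ψ).trans hψ.some⟩

theorem convexEmb_of_isOpenInterval {U : Set ℚ} (hU : IsOpenInterval U) {S : Set (Shuffle A)}
    (hS : lexFst ⁻¹' U ⊆ S) : ConvexEmb (Shuffle A) S :=
  (ConvexEmb.of_subset hS (ordConnected_lexFst_preimage hU.ordConnected)).congr_left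
    (orderIso_of_isOpenInterval hU).some.symm

/-- A convex set that meets two blocks of a shuffle contains a copy of the shuffle. -/
theorem convexEmb_of_lexFst_lt {S : Set (Shuffle A)} (hS : S.OrdConnected) {x y : Shuffle A}
    (hx : x ∈ S) (hy : y ∈ S) (h : lexFst x < lexFst y) : ConvexEmb (Shuffle A) S :=
  convexEmb_of_isOpenInterval (isOpenInterval_Ioo h) fun _ hz =>
    hS.out hx hy ⟨(lt_of_lexFst_lt hz.1).le, (lt_of_lexFst_lt hz.2).le⟩

/-- The blocks before that of a point of `S` all lie in `S` and already form a copy of the shuffle.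
-/
theorem convexEmb_of_isLowerSet {S : Set (Shuffle A)} (hS : IsLowerSet S) (hne : S.Nonempty) :
    ConvexEmb (Shuffle A) S := by
  obtain ⟨x, hx⟩ := hne
  exact convexEmb_of_isOpenInterval (isOpenInterval_Iio (lexFst x)) fun y hy =>
    hS (lt_of_lexFst_lt hy).le hx

theorem convexEmb_of_isUpperSet {S : Set (Shuffle A)} (hS : IsUpperSet S) (hne : S.Nonempty) :
    ConvexEmb (Shuffle A) S := by
  obtain ⟨x, hx⟩ := hne
  exact convexEmb_of_isOpenInterval (isOpenInterval_Ioi (lexFst x)) fun y hy =>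
    hS (lt_of_lexFst_lt hy).le hx

/-- `B` embeds convexly in each of its nonempty initial and final segments. -/
def SelfSimilar (B : Type*) [LinearOrder B] : Prop :=
  ∀ S : Set B, IsLowerSet S ∨ IsUpperSet S → S.Nonempty → ConvexEmb B S

theorem selfSimilar : SelfSimilar (Shuffle A) := fun _ h hne =>
  h.elim (fun h => convexEmb_of_isLowerSet h hne) (fun h => convexEmb_of_isUpperSet h hne)

theorem SelfSimilar.congr {B C : Type*} [LinearOrder B] [LinearOrder C] (e : B ≃o C)
    (h : SelfSimilar B) : SelfSimilar C := fun S hS hne => by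
  have h1 : IsLowerSet (e ⁻¹' S) ∨ IsUpperSet (e ⁻¹' S) :=
    hS.imp (fun h => h.preimage e.monotone) (fun h => h.preimage e.monotone)
  have h2 : ConvexEmb B (e ⁻¹' S) := h _ h1 (hne.preimage e.surjective)
  obtain ⟨φ⟩ := exists_orderIso_image e (e ⁻¹' S)
  rw [image_preimage_eq _ e.surjective] at φ
  exact (h2.congr_right φ).congr_left e

/-- A self-similar convex subset of a shuffle that does not embed in a block is an open interval
of blocks. -/
theorem exists_isOpenInterval [∀ i, Nonempty (A i)] {S : Set (Shuffle A)} (hS : S.OrdConnected)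
    (hne : S.Nonempty) (hss : SelfSimilar S) (hno : ∀ i, ¬ ConvexEmb S (A i)) :
    ∃ U, IsOpenInterval U ∧ S = lexFst ⁻¹' U := by
  -- No nonempty initial or final piece of `S` lies in a single block, since self-similarity would
  -- embed `S` in that block.
  have key : ∀ (T : Set (Shuffle A)) (q : ℚ), T ⊆ S → T.Nonempty →
      ((∀ x ∈ T, ∀ y ∈ S, y ≤ x → y ∈ T) ∨ (∀ x ∈ T, ∀ y ∈ S, x ≤ y → y ∈ T)) →
      T ⊆ lexFst ⁻¹' {q} → False := by
    intro T q hTS hTne hT hTq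
    have hTc : T.OrdConnected := ⟨fun x hx y hy z hz => by
      have hzS := hS.out (hTS hx) (hTS hy) hz
      rcases hT with hT | hT
      · exact hT y hy z hzS hz.2
      · exact hT x hx z hzS hz.1⟩
    have h1 : ConvexEmb S (Subtype.val ⁻¹' T : Set S) := hss _
      (hT.imp (fun h a b hba ha => h a ha b b.2 hba) (fun h a b hab ha => h a ha b b.2 hab))
      (by obtain ⟨x, hx⟩ := hTne; exact ⟨⟨x, hTS hx⟩, hx⟩)
    exact hno _ (((h1.congr_right (orderIso_preimage_val hTS).some).trans (ConvexEmb.of_subset hTq hTc)).congr_right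
      (lexFst_fibre (A := fun q => A (genericColour n q)) q).some.symm)
  -- If `S` misses a point `y` of the block of `x`, convexity confines the piece of `S` on that side
  -- of `x` to the points between `y` and `x`, hence to one block.
  have hsat : ∀ x ∈ S, ∀ y, lexFst y = lexFst x → y ∈ S := by
    intro x hx y hyx
    by_contra hy
    rcases le_total y x with h | h
    · refine key {z ∈ S | z ≤ x} (lexFst x) (fun z hz => hz.1) ⟨x, hx, le_rfl⟩
        (Or.inl fun z hz w hw hwz => ⟨hw, hwz.trans hz.2⟩) fun z hz => ?_
      refine le_antisymm (lexFst_monotone hz.2) (hyx ▸ lexFst_monotone ?_)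
      by_contra hlt
      exact hy (hS.out hz.1 hx ⟨(not_le.1 hlt).le, h⟩)
    · refine key {z ∈ S | x ≤ z} (lexFst x) (fun z hz => hz.1) ⟨x, hx, le_rfl⟩
        (Or.inr fun z hz w hw hwz => ⟨hw, hz.2.trans hwz⟩) fun z hz => ?_
      refine le_antisymm (hyx ▸ lexFst_monotone ?_) (lexFst_monotone hz.2)
      by_contra hlt
      exact hy (hS.out hx hz.1 ⟨h, (not_le.1 hlt).le⟩)
  refine ⟨lexFst '' S, ⟨hne.image _, ⟨?_⟩, ?_, ?_⟩, ?_⟩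
  · rintro _ ⟨x, hx, rfl⟩ _ ⟨y, hy, rfl⟩ w ⟨hw1, hw2⟩
    rcases hw1.lt_or_eq with hw1 | rfl
    · rcases hw2.lt_or_eq with hw2 | rfl
      · obtain ⟨z, rfl⟩ := exists_lexFst_eq (A := fun q => A (genericColour n q)) w
        exact ⟨z, hS.out hx hy ⟨(lt_of_lexFst_lt hw1).le, (lt_of_lexFst_lt hw2).le⟩, rfl⟩
      · exact ⟨y, hy, rfl⟩
    · exact ⟨x, hx, rfl⟩
  · rintro _ ⟨x, hx, rfl⟩
    by_contra hmin
    push Not at hmin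
    refine key {z ∈ S | lexFst z = lexFst x} (lexFst x) (fun z hz => hz.1) ⟨x, hx, rfl⟩
      (Or.inl fun z hz w hw hwz => ⟨hw, ?_⟩) fun z hz => hz.2
    exact le_antisymm (hz.2 ▸ lexFst_monotone hwz) (hmin _ ⟨w, hw, rfl⟩)
  · rintro _ ⟨x, hx, rfl⟩
    by_contra hmax
    push Not at hmax
    refine key {z ∈ S | lexFst z = lexFst x} (lexFst x) (fun z hz => hz.1) ⟨x, hx, rfl⟩
      (Or.inr fun z hz w hw hwz => ⟨hw, ?_⟩) fun z hz => hz.2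
    exact le_antisymm (hmax _ ⟨w, hw, rfl⟩) (hz.2 ▸ lexFst_monotone hwz)
  · ext y
    constructor
    · exact fun hy => ⟨y, hy, rfl⟩
    · rintro ⟨x, hx, hxy⟩
      exact hsat x hx y hxy.symm

/-- The copy of `B` is an open interval of blocks, which is a copy of the whole shuffle. -/
theorem orderIso_of_selfSimilar [∀ i, Nonempty (A i)] {B : Type*} [LinearOrder B] [Nonempty B]
    (hB : SelfSimilar B) (h : ConvexEmb B (Shuffle A)) (hno : ∀ i, ¬ ConvexEmb B (A i)) :
    Nonempty (B ≃o Shuffle A) := by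
  obtain ⟨S, hS, ⟨e⟩⟩ := h.exists_set
  obtain ⟨U, hU, rfl⟩ := exists_isOpenInterval hS ⟨_, (e (Classical.arbitrary B)).2⟩ (hB.congr e)
    fun i h' => hno i (h'.congr_left e.symm)
  exact ⟨e.trans (orderIso_of_isOpenInterval hU).some.symm⟩

end Shuffle

/-- The member of a family selected by an optional index, empty if there is no index. -/
def OptOrd {ι : Type*} (A : ι → Type) : Option ι → Type
  | none => Empty
  | some i => A i

noncomputable instance {ι : Type*} (A : ι → Type) [∀ i, LinearOrder (A i)] :
    ∀ o : Option ι, LinearOrder (OptOrd A o)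
  | none => inferInstanceAs (LinearOrder Empty)
  | some i => inferInstanceAs (LinearOrder (A i))

/-! ### Blocks and copies of a shuffle inside an isomorphic shuffle -/

namespace Shuffle

variable {n : ℕ} {A : Fin (n + 1) → Type} [∀ i, LinearOrder (A i)]

/-- A shuffle with an optional block on either side. -/
abbrev Flank (A : Fin (n + 1) → Type) (o₀ o₁ : Option (Fin (n + 1))) : Type :=
  (OptOrd A o₀ ⊕ₗ Shuffle A) ⊕ₗ OptOrd A o₁

theorem empty_or_singleton_or (W : Set ℚ) :
    W = ∅ ∨ (∃ q, W = {q}) ∨ ∃ a ∈ W, ∃ b ∈ W, a < b := by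
  rcases W.subsingleton_or_nontrivial with h | h
  · rcases h.eq_empty_or_singleton with h | h
    · exact Or.inl h
    · exact Or.inr (Or.inl h)
  · exact Or.inr (Or.inr h.exists_lt)

theorem blockOrderIso (q : ℚ) :
    Nonempty (A (genericColour n q) ≃o (lexFst ⁻¹' {q} : Set (Shuffle A))) :=
  lexFst_fibre (A := fun q => A (genericColour n q)) q

theorem optOrd_orderIso (W : Set ℚ) (hW : W.Subsingleton) :
    ∃ o : Option (Fin (n + 1)), Nonempty ((lexFst ⁻¹' W : Set (Shuffle A)) ≃o OptOrd A o) := by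
  rcases hW.eq_empty_or_singleton with rfl | ⟨q, rfl⟩
  · refine ⟨none, ?_⟩
    have : IsEmpty (OptOrd A none) := inferInstanceAs (IsEmpty Empty)
    have : IsEmpty (lexFst ⁻¹' ∅ : Set (Shuffle A)) := ⟨fun x => x.2⟩
    exact ⟨OrderIso.ofIsEmpty _ _⟩
  · exact ⟨some (genericColour n q), ⟨(blockOrderIso q).some.symm⟩⟩

/-- A convex set of at least two blocks of a shuffle is an open interval of blocks together with
at most one block on either side. -/
theorem exists_flank_orderIso {W : Set ℚ} (hW : W.OrdConnected) {a b : ℚ} (ha : a ∈ W) (hb : b ∈ W)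
    (hab : a < b) : ∃ o₀ o₁, Nonempty ((lexFst ⁻¹' W : Set (Shuffle A)) ≃o Flank A o₀ o₁) := by
  -- `W₀` and `W₁` hold the least and the greatest element of `W`, if there are any; `U` is the
  -- rest.
  let W₀ : Set ℚ := {q ∈ W | ∀ r ∈ W, q ≤ r}
  let W₁ : Set ℚ := {q ∈ W | ∀ r ∈ W, r ≤ q}
  let U : Set ℚ := {q ∈ W | (∃ r ∈ W, r < q) ∧ ∃ r ∈ W, q < r}
  have hU : IsOpenInterval U := by
    refine ⟨?_, ⟨?_⟩, ?_, ?_⟩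
    · obtain ⟨c, h1, h2⟩ := exists_between hab
      exact ⟨c, hW.out ha hb ⟨h1.le, h2.le⟩, ⟨a, ha, h1⟩, ⟨b, hb, h2⟩⟩
    · rintro x ⟨hx, ⟨r, hr, hrx⟩, -⟩ y ⟨hy, -, ⟨s, hs, hsy⟩⟩ z ⟨hxz, hzy⟩
      exact ⟨hW.out hx hy ⟨hxz, hzy⟩, ⟨r, hr, hrx.trans_le hxz⟩, ⟨s, hs, hzy.trans_lt hsy⟩⟩
    · rintro u ⟨hu, ⟨r, hr, hru⟩, ⟨s, hs, hus⟩⟩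
      obtain ⟨c, h1, h2⟩ := exists_between hru
      exact ⟨c, ⟨hW.out hr hu ⟨h1.le, h2.le⟩, ⟨r, hr, h1⟩, ⟨u, hu, h2⟩⟩, h2⟩
    · rintro u ⟨hu, ⟨r, hr, hru⟩, ⟨s, hs, hus⟩⟩
      obtain ⟨c, h1, h2⟩ := exists_between hus
      exact ⟨c, ⟨hW.out hu hs ⟨h1.le, h2.le⟩, ⟨u, hu, h1⟩, ⟨s, hs, h2⟩⟩, h1⟩
  have hcover : W = (W₀ ∪ U) ∪ W₁ := by
    ext q
    constructor
    · intro hq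
      by_cases h0 : ∀ r ∈ W, q ≤ r
      · exact Or.inl (Or.inl ⟨hq, h0⟩)
      · by_cases h1 : ∀ r ∈ W, r ≤ q
        · exact Or.inr ⟨hq, h1⟩
        · push Not at h0 h1
          exact Or.inl (Or.inr ⟨hq, h0, h1⟩)
    · rintro ((h | h) | h) <;> exact h.1
  obtain ⟨o₀, ⟨e₀⟩⟩ := optOrd_orderIso (A := A) W₀
    fun x hx y hy => le_antisymm (hx.2 y hy.1) (hy.2 x hx.1)
  obtain ⟨o₁, ⟨e₁⟩⟩ := optOrd_orderIso (A := A) W₁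
    fun x hx y hy => le_antisymm (hy.2 x hx.1) (hx.2 y hy.1)
  obtain ⟨e⟩ := orderIso_of_isOpenInterval (A := A) hU
  have h01 : ∀ x ∈ W₀, ∀ y ∈ U, x < y := fun x hx y hy => by
    obtain ⟨r, hr, hry⟩ := hy.2.1
    exact (hx.2 r hr).trans_lt hry
  have h12 : ∀ x ∈ W₀ ∪ U, ∀ y ∈ W₁, x < y := by
    rintro x (hx | hx) y hy
    · exact ((hx.2 a ha).trans_lt hab).trans_le (hy.2 b hb)
    · obtain ⟨r, hr, hxr⟩ := hx.2.2
      exact hxr.trans_le (hy.2 r hr)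
  obtain ⟨f⟩ := orderIso_union (X := Shuffle A) (S := lexFst ⁻¹' W₀) (T := lexFst ⁻¹' U)
    fun x hx y hy => lt_of_lexFst_lt (h01 _ hx _ hy)
  obtain ⟨g⟩ := orderIso_union (X := Shuffle A) (S := lexFst ⁻¹' W₀ ∪ lexFst ⁻¹' U)
    (T := lexFst ⁻¹' W₁) fun x hx y hy => lt_of_lexFst_lt (h12 _ hx _ hy)
  obtain ⟨k⟩ := orderIso_setCongr (X := Shuffle A) (congrArg (fun W => lexFst ⁻¹' W) hcover)
  exact ⟨o₀, o₁, ⟨(k.trans g).trans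
    ((f.trans (e₀.sumLexCongr e.symm)).sumLexCongr e₁)⟩⟩

theorem isLowerSet_of_preimage [∀ i, Nonempty (A i)] {U : Set ℚ}
    (h : IsLowerSet (lexFst ⁻¹' U : Set (Shuffle A))) : IsLowerSet U := by
  intro a b hba ha
  rcases hba.lt_or_eq with hba | rfl
  · obtain ⟨x, rfl⟩ := exists_lexFst_eq (A := fun q => A (genericColour n q)) a
    obtain ⟨y, rfl⟩ := exists_lexFst_eq (A := fun q => A (genericColour n q)) b
    exact h (lt_of_lexFst_lt hba).le ha
  · exact ha

theorem isUpperSet_of_preimage [∀ i, Nonempty (A i)] {U : Set ℚ}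
    (h : IsUpperSet (lexFst ⁻¹' U : Set (Shuffle A))) : IsUpperSet U := by
  intro a b hba ha
  rcases hba.lt_or_eq with hba | rfl
  · obtain ⟨x, rfl⟩ := exists_lexFst_eq (A := fun q => A (genericColour n q)) a
    obtain ⟨y, rfl⟩ := exists_lexFst_eq (A := fun q => A (genericColour n q)) b
    exact h (lt_of_lexFst_lt hba).le ha
  · exact ha

/-- The blocks of a shuffle, viewed in an isomorphic shuffle that does not embed in its own
blocks. -/
theorem block_cases [∀ i, Nonempty (A i)] {m : ℕ} {B : Fin (m + 1) → Type}
    [∀ i, LinearOrder (B i)] [∀ i, Nonempty (B i)] (e : Shuffle A ≃o Shuffle B)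
    (hno : ∀ j, ¬ ConvexEmb (Shuffle B) (B j)) (i : Fin (n + 1)) :
    (∃ j, Nonempty (A i ≃o B j)) ∨ ∃ o₀ o₁, Nonempty (A i ≃o Flank B o₀ o₁) := by
  obtain ⟨q, rfl⟩ := exists_colour n i
  -- The image of an open interval of blocks is self-similar and, being a copy of the whole shuffle,
  -- does not embed in a block of `B`; so it is again an open interval of blocks.
  have himage : ∀ U : Set ℚ, IsOpenInterval U →
      ∃ V, IsOpenInterval V ∧ e.symm ⁻¹' (lexFst ⁻¹' U) = lexFst ⁻¹' V := fun U hU => by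
    obtain ⟨φ⟩ := exists_orderIso_image e (lexFst ⁻¹' U)
    obtain ⟨ψ⟩ := orderIso_of_isOpenInterval (A := A) hU
    rw [e.image_eq_preimage_symm] at φ
    refine exists_isOpenInterval ((ordConnected_lexFst_preimage hU.ordConnected).preimage_mono
      e.symm.monotone) ⟨_, (φ (ψ (e.symm (Classical.arbitrary _)))).2⟩
      (selfSimilar.congr (ψ.trans φ)) fun j hj => hno j ?_
    exact ((hj.congr_left φ.symm).congr_left ψ.symm).congr_left e
  obtain ⟨V₀, -, h₀⟩ := himage _ (isOpenInterval_Iio q)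
  obtain ⟨V₁, -, h₁⟩ := himage _ (isOpenInterval_Ioi q)
  have hV₀ : IsLowerSet V₀ := isLowerSet_of_preimage
    (h₀ ▸ ((isLowerSet_Iio q).preimage lexFst_monotone).preimage e.symm.monotone)
  have hV₁ : IsUpperSet V₁ := isUpperSet_of_preimage
    (h₁ ▸ ((isUpperSet_Ioi q).preimage lexFst_monotone).preimage e.symm.monotone)
  have hW : (V₀ ∪ V₁)ᶜ.OrdConnected := by
    rw [compl_union]
    exact hV₀.compl.ordConnected.inter hV₁.compl.ordConnected
  -- The block at `q` is what remains between the two open intervals on its sides, so its image is a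
  -- convex union of whole blocks; the number of these decides the case.
  have hWeq : e '' (lexFst ⁻¹' {q}) = lexFst ⁻¹' (V₀ ∪ V₁)ᶜ := by
    rw [preimage_compl, preimage_union, ← h₀, ← h₁, ← preimage_union, ← preimage_union,
      ← preimage_compl, ← preimage_compl, Iio_union_Ioi, compl_compl, e.image_eq_preimage_symm]
  obtain ⟨φ⟩ := exists_orderIso_image e (lexFst ⁻¹' {q})
  rw [hWeq] at φ
  have φ' := (blockOrderIso q).some.trans φ
  rcases empty_or_singleton_or (V₀ ∪ V₁)ᶜ with h | ⟨r, h⟩ | ⟨a, ha, b, hb, hab⟩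
  · rw [h] at φ'
    exact absurd (φ' (Classical.arbitrary _)).2 (notMem_empty _)
  · rw [h] at φ'
    exact Or.inl ⟨_, ⟨φ'.trans (blockOrderIso r).some.symm⟩⟩
  · obtain ⟨o₀, o₁, ⟨ψ⟩⟩ := exists_flank_orderIso (A := B) hW ha hb hab
    exact Or.inr ⟨o₀, o₁, ⟨φ'.trans ψ⟩⟩

/-- What lies between two convex copies of a shuffle inside this shuffle. -/
theorem between_cases [∀ i, Nonempty (A i)] (hno : ∀ j, ¬ ConvexEmb (Shuffle A) (A j))
    {S₀ S₁ : Set (Shuffle A)} (h₀ : S₀.OrdConnected) (h₁ : S₁.OrdConnected)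
    (e₀ : Shuffle A ≃o S₀) (e₁ : Shuffle A ≃o S₁) {C : Set (Shuffle A)} (hC : C.OrdConnected)
    (hCeq : ∀ x, x ∈ C ↔ (∀ y ∈ S₀, y < x) ∧ ∀ y ∈ S₁, x < y) :
    C = ∅ ∨ (∃ i, Nonempty (C ≃o A i)) ∨ ConvexEmb (Shuffle A) C := by
  obtain ⟨V₀, hV₀, rfl⟩ := exists_isOpenInterval h₀ ⟨_, (e₀ (Classical.arbitrary _)).2⟩
    (selfSimilar.congr e₀) fun j hj => hno j (hj.congr_left e₀.symm)
  obtain ⟨V₁, hV₁, rfl⟩ := exists_isOpenInterval h₁ ⟨_, (e₁ (Classical.arbitrary _)).2⟩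
    (selfSimilar.congr e₁) fun j hj => hno j (hj.congr_left e₁.symm)
  -- `V₀` has no last and `V₁` no first element, so comparing points with the two copies amounts to
  -- comparing blocks, and `C` is a union of whole blocks.
  have hW : C = lexFst ⁻¹' {q | (∀ v ∈ V₀, v < q) ∧ ∀ v ∈ V₁, q < v} := by
    ext x
    rw [hCeq]
    constructor
    · rintro ⟨hx₀, hx₁⟩
      refine ⟨fun v hv => ?_, fun v hv => ?_⟩
      · obtain ⟨w, hw, hvw⟩ := hV₀.exists_gt v hv
        obtain ⟨y, rfl⟩ := exists_lexFst_eq (A := fun q => A (genericColour n q)) w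
        exact hvw.trans_le (lexFst_monotone (hx₀ y hw).le)
      · obtain ⟨w, hw, hvw⟩ := hV₁.exists_lt v hv
        obtain ⟨y, rfl⟩ := exists_lexFst_eq (A := fun q => A (genericColour n q)) w
        exact (lexFst_monotone (hx₁ y hw).le).trans_lt hvw
    · rintro ⟨hx₀, hx₁⟩
      exact ⟨fun y hy => lt_of_lexFst_lt (hx₀ _ hy), fun y hy => lt_of_lexFst_lt (hx₁ _ hy)⟩
  rcases empty_or_singleton_or {q | (∀ v ∈ V₀, v < q) ∧ ∀ v ∈ V₁, q < v} with
    h | ⟨r, h⟩ | ⟨a, ha, b, hb, hab⟩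
  · exact Or.inl (by rw [hW, h, preimage_empty])
  · refine Or.inr (Or.inl ⟨genericColour n r, ?_⟩)
    rw [hW, h]
    exact ⟨(blockOrderIso r).some.symm⟩
  · obtain ⟨x, rfl⟩ := exists_lexFst_eq (A := fun q => A (genericColour n q)) a
    obtain ⟨y, rfl⟩ := exists_lexFst_eq (A := fun q => A (genericColour n q)) b
    exact Or.inr (Or.inr (convexEmb_of_lexFst_lt hC (hW ▸ ha) (hW ▸ hb) hab))

end Shuffle

/-- A convex copy of a shuffle in a well-ordered sum has a copy in a summand. -/
theorem exists_convexEmb_inter_fibre {n : ℕ} {A : Fin (n + 1) → Type} [∀ i, LinearOrder (A i)]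
    [∀ i, Nonempty (A i)] {B : ℕ → Type} [∀ i, LinearOrder (B i)] {S : Set (Σₗ i, B i)}
    (h : ConvexEmb (Shuffle A) S) :
    ∃ l, ConvexEmb (Shuffle A) ↥(S ∩ lexFst ⁻¹' {l}) := by
  obtain ⟨f, hf⟩ := h
  -- If two different blocks have points in the same summand, the open interval of blocks between
  -- these points stays in it and is a copy of the shuffle.
  by_cases hxy : ∃ x y, lexFst x < lexFst y ∧ lexFst (f x).1 = lexFst (f y).1
  · obtain ⟨x, y, hlt, heq⟩ := hxy
    refine ⟨lexFst (f x).1, ?_⟩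
    have hmem : ∀ z : Shuffle A, lexFst z ∈ Ioo (lexFst x) (lexFst y) →
        lexFst (f z).1 = lexFst (f x).1 := fun z hz =>
      le_antisymm (heq ▸ lexFst_monotone (f.monotone (lt_of_lexFst_lt hz.2).le))
        (lexFst_monotone (f.monotone (lt_of_lexFst_lt hz.1).le))
    obtain ⟨ψ⟩ := Shuffle.orderIso_of_isOpenInterval (A := A) (Shuffle.isOpenInterval_Ioo hlt)
    refine ConvexEmb.congr_left ψ.symm ⟨⟨⟨fun z => ⟨(f z.1).1, (f z.1).2, hmem _ z.2⟩,
      fun z w hzw => ?_⟩, ?_⟩, ⟨?_⟩⟩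
    · exact Subtype.ext (f.injective (Subtype.ext (Subtype.mk.inj hzw)))
    · intro z w
      exact f.le_iff_le
    · rintro _ ⟨z, rfl⟩ _ ⟨w, rfl⟩ v ⟨hzv, hvw⟩
      obtain ⟨u, hu⟩ := hf.out ⟨z.1, rfl⟩ ⟨w.1, rfl⟩ (show (⟨v.1, v.2.1⟩ : S) ∈ _ from ⟨hzv, hvw⟩)
      have hzu : z.1 ≤ u := f.le_iff_le.1 (hu ▸ hzv)
      have huw : u ≤ w.1 := f.le_iff_le.1 (hu ▸ hvw)
      refine ⟨⟨u, (ordConnected_lexFst_preimage ordConnected_Ioo).out z.2 w.2 ⟨hzu, huw⟩⟩, ?_⟩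
      exact Subtype.ext (show (f u).1 = v.1 by rw [hu])
  -- Otherwise one point from each block gives a strictly increasing map from `ℚ` to `ℕ`.
  · exfalso
    push Not at hxy
    choose g hg using fun q : ℚ => exists_lexFst_eq (A := fun q => A (genericColour n q)) q
    have hmono : StrictMono fun q : ℚ => lexFst (f (g q)).1 := fun a b hab => by
      have hlt : lexFst (g a) < lexFst (g b) := by rw [hg, hg]; exact hab
      exact lt_of_le_of_ne (lexFst_monotone (f.monotone (lt_of_lexFst_lt hlt).le)) (hxy _ _ hlt)
    have := hmono.wellFoundedLT
    obtain ⟨m, -, hm⟩ := this.wf.has_min (univ : Set ℚ) univ_nonempty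
    exact hm (m - 1) (mem_univ _) (sub_one_lt m)

namespace OTerm

/-! ### Linear orders of terms and of sequences of terms -/

theorem shuffle_orderIso {n : ℕ} (p : Fin (n + 1) → OTerm) :
    Nonempty ((shuffle n p).toLinOrd ≃o Shuffle fun i => (p i).toLinOrd) :=
  ⟨OrderIso.refl _⟩

theorem concat_orderIso (s t : OTerm) :
    Nonempty ((concat s t).toLinOrd ≃o s.toLinOrd ⊕ₗ t.toLinOrd) :=
  ⟨OrderIso.refl _⟩

instance nonempty_toLinOrd : ∀ t : OTerm, Nonempty t.toLinOrd
  | one => ⟨(() : Unit)⟩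
  | concat s t =>
    have := nonempty_toLinOrd s
    (concat_orderIso s t).some.symm.toEquiv.nonempty_congr.1
      ⟨toLex (Sum.inl (Classical.arbitrary _))⟩
  | shuffle n p =>
    have := fun i => nonempty_toLinOrd (p i)
    (shuffle_orderIso p).some.symm.toEquiv.nonempty_congr.1
      ⟨toLex ⟨0, Classical.arbitrary (p (genericColour n 0)).toLinOrd⟩⟩

instance noMinOrder_shuffle {n : ℕ} (p : Fin (n + 1) → OTerm) :
    NoMinOrder (shuffle n p).toLinOrd :=
  inferInstanceAs (NoMinOrder (Σₗ q : ℚ, (p (genericColour n q)).toLinOrd))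

instance noMaxOrder_shuffle {n : ℕ} (p : Fin (n + 1) → OTerm) :
    NoMaxOrder (shuffle n p).toLinOrd :=
  inferInstanceAs (NoMaxOrder (Σₗ q : ℚ, (p (genericColour n q)).toLinOrd))

instance infinite_shuffle {n : ℕ} (p : Fin (n + 1) → OTerm) :
    Infinite (shuffle n p).toLinOrd := NoMaxOrder.infinite

theorem not_isFinite_shuffle {n : ℕ} (p : Fin (n + 1) → OTerm) : ¬ (shuffle n p).IsFinite :=
  fun h => not_finite_iff_infinite.2 (infinite_shuffle p) h

theorem Same.orderIso {s t : OTerm} (h : Same s t) : Nonempty (s.toLinOrd ≃o t.toLinOrd) := by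
  induction h with
  | refl t => exact ⟨OrderIso.refl _⟩
  | symm _ ih => exact ⟨ih.some.symm⟩
  | trans _ _ ih₁ ih₂ => exact ⟨ih₁.some.trans ih₂.some⟩
  | assoc s t u => exact ⟨OrderIso.sumLexAssoc _ _ _⟩
  | concat _ _ ih₁ ih₂ => exact ⟨ih₁.some.sumLexCongr ih₂.some⟩
  | @shuffle n m s t e _ ih =>
    -- Renaming colours along `e` keeps the colouring interdense, so Cantor's theorem gives an
    -- automorphism of `ℚ` carrying it to the other colouring.
    have hd : Interdense fun q => e (genericColour n q) := fun x y hxy i => by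
      obtain ⟨z, h1, h2, h3⟩ := genericColour_interdense n x y hxy (e.symm i)
      exact ⟨z, h1, h2, (congrArg e h3).trans (e.apply_symm_apply i)⟩
    obtain ⟨f, hf⟩ := exists_orderIso_of_interdense hd (genericColour_interdense m)
    refine orderIso_of_fibres (X := Shuffle fun i => (s i).toLinOrd)
      (Y := Shuffle fun i => (t i).toLinOrd) lexFst_monotone lexFst_monotone f fun q => ?_
    obtain ⟨φ⟩ := Shuffle.blockOrderIso (A := fun i => (s i).toLinOrd) q
    obtain ⟨ψ⟩ := Shuffle.blockOrderIso (A := fun i => (t i).toLinOrd) (f q)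
    obtain ⟨χ⟩ := ih (genericColour n q)
    have hq : e (genericColour n q) = genericColour m (f q) := (hf q).symm
    rw [hq] at χ
    exact ⟨(φ.symm.trans χ).trans ψ⟩

/-- The linear order of an optional term, empty if there is no term. -/
noncomputable abbrev optOrd (o : Option OTerm) : Type := OptOrd (fun t : OTerm => t.toLinOrd) o

/-- The linear order encoded by a sequence of optional terms. -/
noncomputable abbrev seqOrd (T : ℕ → Option OTerm) : Type := Σₗ i : ℕ, optOrd (T i)

/-- The concatenation of a nonempty list of terms. -/
def cat : List OTerm → OTerm
  | [] => one
  | a :: l => l.foldl concat a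

theorem cat_append_singleton {l : List OTerm} (hl : l ≠ []) (b : OTerm) :
    cat (l ++ [b]) = concat (cat l) b := by
  cases l with
  | nil => exact absurd rfl hl
  | cons a l => simp [cat]

theorem isConcat_iff {l : List OTerm} {t : OTerm} : IsConcat l t ↔ l ≠ [] ∧ Same (cat l) t := by
  cases l with
  | nil => simp [IsConcat]
  | cons a l => simp [IsConcat, cat]

/-- The list `l` occurs in the sequence from the index `i` on. -/
def Segment (T : ℕ → Option OTerm) (i : ℕ) (l : List OTerm) : Prop :=
  ∀ k (hk : k < l.length), T (i + k) = some l[k]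

theorem Segment.left {T : ℕ → Option OTerm} {i : ℕ} {l l' : List OTerm}
    (h : Segment T i (l ++ l')) : Segment T i l := fun k hk => by
  rw [h k (by simp; omega), List.getElem_append_left hk]

theorem Segment.right {T : ℕ → Option OTerm} {i : ℕ} {l l' : List OTerm}
    (h : Segment T i (l ++ l')) : Segment T (i + l.length) l' := fun k hk => by
  rw [add_assoc, h (l.length + k) (by simp; omega)]
  simp

theorem Segment.append {T : ℕ → Option OTerm} {i : ℕ} {l l' : List OTerm}
    (h : Segment T i l) (h' : Segment T (i + l.length) l') : Segment T i (l ++ l') := fun k hk => by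
  rcases lt_or_ge k l.length with hkl | hkl
  · rw [h k hkl, List.getElem_append_left hkl]
  · rw [List.getElem_append_right hkl, ← h' (k - l.length) (by simp at hk; omega)]
    congr 1; omega

theorem segment_singleton {T : ℕ → Option OTerm} {i : ℕ} {a : OTerm} :
    Segment T i [a] ↔ T i = some a := by
  constructor
  · intro h; exact h 0 (by simp)
  · intro h k hk
    obtain rfl : k = 0 := by simpa using hk
    exact h

theorem optOrd_fibre {T : ℕ → Option OTerm} {i : ℕ} {a : OTerm} (h : T i = some a) :
    Nonempty (a.toLinOrd ≃o (lexFst ⁻¹' {i} : Set (seqOrd T))) := by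
  obtain ⟨φ⟩ := lexFst_fibre (A := fun i => optOrd (T i)) i
  rw [h] at φ
  exact ⟨φ⟩

theorem isEmpty_fibre {T : ℕ → Option OTerm} {i : ℕ} (h : T i = none) :
    IsEmpty (lexFst ⁻¹' {i} : Set (seqOrd T)) := by
  obtain ⟨φ⟩ := lexFst_fibre (A := fun i => optOrd (T i)) i
  rw [h] at φ
  exact ⟨fun x => (φ.symm x : Empty).elim⟩

theorem exists_some {T : ℕ → Option OTerm} (x : seqOrd T) : ∃ t, T (lexFst x) = some t := by
  cases h : T (lexFst x) with
  | none => exact ((isEmpty_fibre h).false ⟨x, rfl⟩).elim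
  | some t => exact ⟨t, rfl⟩

theorem segment_orderIso {T : ℕ → Option OTerm} {i : ℕ} {l : List OTerm} (hl : l ≠ [])
    (h : Segment T i l) :
    Nonempty ((cat l).toLinOrd ≃o (lexFst ⁻¹' Ico i (i + l.length) : Set (seqOrd T))) := by
  induction l using List.reverseRecOn with
  | nil => exact absurd rfl hl
  | append_singleton l b ih =>
    have hb := optOrd_fibre (segment_singleton.1 h.right)
    rcases eq_or_ne l [] with rfl | hl
    · have : Ico i (i + ([] ++ [b]).length) = {i + ([] : List OTerm).length} := by ext; simp; omega
      rw [this]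
      exact hb
    · rw [cat_append_singleton hl]
      obtain ⟨φ⟩ := ih hl h.left
      have : Ico i (i + (l ++ [b]).length) = Ico i (i + l.length) ∪ {i + l.length} := by
        ext; simp; omega
      rw [this, preimage_union]
      obtain ⟨ψ⟩ := orderIso_union (X := seqOrd T) (S := lexFst ⁻¹' Ico i (i + l.length))
        (T := lexFst ⁻¹' {i + l.length}) fun x hx y hy => lt_of_lexFst_lt (by
          have h1 : lexFst y = i + l.length := hy
          rw [h1]; exact hx.2)
      exact ⟨((concat_orderIso _ _).some.trans (φ.sumLexCongr hb.some)).trans ψ.symm⟩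

theorem tail_orderIso (T : ℕ → Option OTerm) :
    Nonempty (seqOrd (fun i => T (i + 1)) ≃o (lexFst ⁻¹' Ici 1 : Set (seqOrd T))) := by
  let F : seqOrd (fun i => T (i + 1)) → (lexFst ⁻¹' Ici 1 : Set (seqOrd T)) := fun x =>
    ⟨toLex ⟨(ofLex x).1 + 1, (ofLex x).2⟩, Nat.succ_le_succ (Nat.zero_le _)⟩
  have hmono : StrictMono F := by
    rintro ⟨i, x⟩ ⟨j, y⟩ hxy
    rcases hxy with ⟨_, _, h⟩ | ⟨_, _, h⟩
    · exact Sigma.Lex.left _ _ (Nat.succ_lt_succ h)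
    · exact Sigma.Lex.right _ _ h
  refine ⟨hmono.orderIsoOfSurjective F ?_⟩
  rintro ⟨⟨i, x⟩, hi⟩
  obtain ⟨i, rfl⟩ : ∃ j, i = j + 1 := Nat.exists_eq_succ_of_ne_zero (Nat.one_le_iff_ne_zero.1 hi)
  exact ⟨toLex ⟨i, x⟩, rfl⟩

/-! ### Sequences that cannot be simplified -/

/-- The shuffle of `p` does not embed convexly in any of the orders that are shuffled. -/
def Tight {n : ℕ} (p : Fin (n + 1) → OTerm) : Prop :=
  ∀ i, ¬ ConvexEmb (shuffle n p).toLinOrd (p i).toLinOrd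

/-- If the shuffle of `p` embedded in some `r i`, so would the shuffle of `r`, against tightness;
hence `Shuffle.orderIso_of_selfSimilar` applies. -/
theorem Tight.of_convexEmb {n m : ℕ} {p : Fin (n + 1) → OTerm} {r : Fin (m + 1) → OTerm}
    (hr : Tight r) (h₁ : ConvexEmb (shuffle n p).toLinOrd (shuffle m r).toLinOrd)
    (h₂ : ConvexEmb (shuffle m r).toLinOrd (shuffle n p).toLinOrd) :
    Nonempty ((shuffle n p).toLinOrd ≃o (shuffle m r).toLinOrd) :=
  Shuffle.orderIso_of_selfSimilar (A := fun i => (r i).toLinOrd)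
    (Shuffle.selfSimilar (A := fun i => (p i).toLinOrd)) h₁ fun i hi => hr i (h₂.trans hi)

/-- A sequence of terms for which the representation of its order as a sum is canonical. -/
structure IsGood (T : ℕ → Option OTerm) : Prop where
  none_succ : ∀ i, T i = none → T (i + 1) = none
  component : ∀ i t, T i = some t → t.IsFinite ∨ ∃ n p, t = shuffle n p ∧ Tight p
  not_absorbing : ∀ (i n : ℕ) (p : Fin (n + 1) → OTerm) (m : List OTerm) (P : OTerm),
    Segment T i (shuffle n p :: (m ++ [P])) →
    Nonempty ((shuffle n p).toLinOrd ≃o P.toLinOrd) →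
    ¬ (m = [] ∨ m ≠ [] ∧ ∃ j, Nonempty ((cat m).toLinOrd ≃o (p j).toLinOrd))

theorem IsGood.tail {T : ℕ → Option OTerm} (h : IsGood T) : IsGood fun i => T (i + 1) where
  none_succ i := h.none_succ (i + 1)
  component i := h.component (i + 1)
  not_absorbing i n p m P hs := h.not_absorbing (i + 1) n p m P fun k hk => by
    rw [← hs k hk]; congr 1; omega

theorem IsGood.tight {T : ℕ → Option OTerm} (h : IsGood T) {i n : ℕ} {p : Fin (n + 1) → OTerm}
    (hi : T i = some (shuffle n p)) : Tight p := by
  rcases h.component i _ hi with hf | ⟨m, r, hr, ht⟩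
  · exact absurd hf (not_isFinite_shuffle p)
  · cases hr; exact ht

theorem IsGood.exists_segment {T : ℕ → Option OTerm} (h : IsGood T) {i k : ℕ} {t : OTerm}
    (ht : T (i + k) = some t) : ∃ l, l.length = k ∧ Segment T i l := by
  induction k generalizing t with
  | zero => exact ⟨[], rfl, fun k hk => absurd hk (Nat.not_lt_zero _)⟩
  | succ k ih =>
    cases hk : T (i + k) with
    | none =>
      have := h.none_succ _ hk
      rw [add_assoc, ht] at this
      exact absurd this (by simp)
    | some s =>
      obtain ⟨l, rfl, hl⟩ := ih hk
      exact ⟨l ++ [s], by simp, hl.append (segment_singleton.2 hk)⟩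

/-- A component that contains an infinite convex set is a shuffle. -/
theorem IsGood.exists_shuffle {T : ℕ → Option OTerm} (h : IsGood T) {l : ℕ} {B : Type*}
    [LinearOrder B] [Infinite B] (hB : ConvexEmb B (lexFst ⁻¹' {l} : Set (seqOrd T))) :
    ∃ n p, T l = some (shuffle n p) ∧ Tight p := by
  obtain ⟨f, -⟩ := hB
  obtain ⟨t, ht⟩ : ∃ t, T l = some t := by
    obtain ⟨x, hx⟩ := f (Classical.arbitrary B)
    obtain rfl : lexFst x = l := hx
    exact exists_some x
  rcases h.component l t ht with hf | ⟨n, p, rfl, hp⟩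
  · have : Finite t.toLinOrd := hf
    exact absurd (Finite.of_injective (fun b => (optOrd_fibre ht).some.symm (f b))
      ((OrderIso.injective _).comp f.injective)) (not_finite_iff_infinite.2 inferInstance)
  · exact ⟨n, p, ht, hp⟩

/-- A leading shuffle of a good sequence is a maximal initial segment of its isomorphism type. -/
theorem IsGood.eq_fibre {T : ℕ → Option OTerm} (h : IsGood T) {n : ℕ} {p : Fin (n + 1) → OTerm}
    (h0 : T 0 = some (shuffle n p)) {M : Set (seqOrd T)} (hM : IsLowerSet M)
    (hsub : lexFst ⁻¹' {0} ⊆ M) (e : (shuffle n p).toLinOrd ≃o M) : M = lexFst ⁻¹' {0} := by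
  classical
  by_contra hne
  have hp : Tight p := h.tight h0
  have hss : Shuffle.SelfSimilar (shuffle n p).toLinOrd :=
    Shuffle.selfSimilar (A := fun i => (p i).toLinOrd)
  have hDc : (M ∩ lexFst ⁻¹' Ici 1).OrdConnected :=
    hM.ordConnected.inter (ordConnected_lexFst_preimage ordConnected_Ici)
  -- The part of `M` beyond component `0` is a nonempty final segment of a self-similar order.
  have hD : ConvexEmb (shuffle n p).toLinOrd ↥(M ∩ lexFst ⁻¹' Ici 1) := by
    have h1 : ConvexEmb M (Subtype.val ⁻¹' (M ∩ lexFst ⁻¹' Ici 1) : Set M) := by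
      refine (hss.congr e) _ (Or.inr fun a b hab ha => ⟨b.2, ?_⟩) ?_
      · exact le_trans ha.2 (lexFst_monotone (A := fun i => optOrd (T i)) hab)
      · obtain ⟨x, hx, hx0⟩ := exists_of_ssubset (hsub.ssubset_of_ne (Ne.symm hne))
        exact ⟨⟨x, hx⟩, hx, Nat.one_le_iff_ne_zero.2 hx0⟩
    exact (h1.congr_right (orderIso_preimage_val inter_subset_left).some).congr_left e.symm
  have hex : ∃ l, ConvexEmb (shuffle n p).toLinOrd
      ↥((M ∩ lexFst ⁻¹' Ici 1) ∩ lexFst ⁻¹' {l}) :=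
    exists_convexEmb_inter_fibre (A := fun i => (p i).toLinOrd) hD
  obtain ⟨l, hl, hmin⟩ : ∃ l, ConvexEmb (shuffle n p).toLinOrd
      ↥((M ∩ lexFst ⁻¹' Ici 1) ∩ lexFst ⁻¹' {l}) ∧ ∀ k < l, ¬ ConvexEmb (shuffle n p).toLinOrd
      ↥((M ∩ lexFst ⁻¹' Ici 1) ∩ lexFst ⁻¹' {k}) :=
    ⟨Nat.find hex, Nat.find_spec hex, fun k hk => Nat.find_min hex hk⟩
  obtain ⟨x₀, ⟨hx₀M, hx₀1⟩, hx₀l⟩ : ((M ∩ lexFst ⁻¹' Ici 1) ∩ lexFst ⁻¹' {l}).Nonempty := by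
    obtain ⟨f, -⟩ := hl
    exact ⟨_, (f (Classical.arbitrary _)).2⟩
  have hl1 : 1 ≤ l := by
    have h1 : lexFst x₀ = l := hx₀l
    rw [← h1]; exact hx₀1
  have hlf : ConvexEmb (shuffle n p).toLinOrd (lexFst ⁻¹' {l} : Set (seqOrd T)) :=
    hl.trans (ConvexEmb.of_subset inter_subset_right
      (hDc.inter (ordConnected_lexFst_preimage ordConnected_singleton)))
  obtain ⟨m, r, hr, hrt⟩ := h.exists_shuffle hlf
  obtain ⟨φ⟩ := optOrd_fibre hr
  -- an initial segment of the shuffle at `l` that lies in `M`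
  obtain ⟨K, hKM, hKl, hKne, hKlow, ⟨ψ⟩⟩ : ∃ K : Set (seqOrd T), K ⊆ M ∧ K ⊆ lexFst ⁻¹' {l} ∧
      K.Nonempty ∧ (∀ x ∈ K, ∀ y ≤ x, lexFst y = l → y ∈ K) ∧
      Nonempty ((shuffle m r).toLinOrd ≃o K) := by
    -- `M` may end inside component `l`, so only the blocks before that of a point of `M` are taken.
    obtain ⟨z₀, hz₀⟩ := φ.surjective ⟨x₀, hx₀l⟩
    have hU := Shuffle.isOpenInterval_Iio (lexFst (A := fun q => (r (genericColour m q)).toLinOrd) z₀)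
    let K : Set (seqOrd T) := {y | ∃ hy : lexFst y = l,
      lexFst (A := fun q => (r (genericColour m q)).toLinOrd) (φ.symm ⟨y, hy⟩) ∈
        Iio (lexFst (A := fun q => (r (genericColour m q)).toLinOrd) z₀)}
    have hKl : K ⊆ lexFst ⁻¹' {l} := fun y hy => hy.1
    obtain ⟨χ⟩ := Shuffle.orderIso_of_isOpenInterval (A := fun i => (r i).toLinOrd) hU
    obtain ⟨ω⟩ := orderIso_preimage φ hKl
    have hset : {a | (φ a : seqOrd T) ∈ K} = lexFst (A := fun q => (r (genericColour m q)).toLinOrd)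
        ⁻¹' Iio (lexFst (A := fun q => (r (genericColour m q)).toLinOrd) z₀) := by
      ext a
      constructor
      · rintro ⟨hy, ha⟩
        have : φ.symm ⟨φ a, hy⟩ = a := φ.symm_apply_apply a
        rw [this] at ha
        exact ha
      · intro ha
        refine ⟨(φ a).2, ?_⟩
        have : φ.symm ⟨φ a, (φ a).2⟩ = a := φ.symm_apply_apply a
        rw [this]
        exact ha
    rw [hset] at ω
    refine ⟨K, ?_, hKl, ?_, ?_, ⟨χ.trans ω⟩⟩
    · rintro y ⟨hy, hlt⟩
      have h1 : φ.symm ⟨y, hy⟩ < z₀ := lt_of_lexFst_lt hlt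
      have h2 := φ.strictMono h1
      rw [φ.apply_symm_apply, hz₀] at h2
      exact hM (le_of_lt h2) hx₀M
    · exact ⟨_, (ω (χ (Classical.arbitrary _))).2⟩
    · rintro x ⟨hx, hlt⟩ y hyx hy
      have hle : φ.symm ⟨y, hy⟩ ≤ φ.symm ⟨x, hx⟩ := φ.symm.monotone hyx
      exact ⟨hy, (lexFst_monotone (A := fun q => (r (genericColour m q)).toLinOrd) hle).trans_lt hlt⟩
  have hKc : K.OrdConnected := ⟨fun x hx y hy z hz => by
    refine hKlow y hy z hz.2 (le_antisymm ?_ ?_)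
    · exact (lexFst_monotone hz.2).trans_eq (hKl hy)
    · exact (hKl hx).symm.trans_le (lexFst_monotone hz.1)⟩
  have hpr : ConvexEmb (shuffle n p).toLinOrd (shuffle m r).toLinOrd := hlf.congr_right φ.symm
  -- `K` is a copy of the shuffle of `r` lying in `M`, a copy of the shuffle of `p`.
  have hrp : ConvexEmb (shuffle m r).toLinOrd (shuffle n p).toLinOrd :=
    ((ConvexEmb.of_subset hKM hKc).congr_left ψ.symm).congr_right e.symm
  obtain ⟨θ⟩ := hrt.of_convexEmb hpr hrp
  have hgmono : Monotone fun z => (e z : seqOrd T) := fun a b hab => e.monotone hab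
  have hEM : (lexFst ⁻¹' Ico 1 l : Set (seqOrd T)) ⊆ M := fun x hx => by
    obtain ⟨k, hk⟩ := hKne
    exact hM (lt_of_lexFst_lt (hx.2.trans_eq (hKl hk).symm)).le (hKM hk)
  obtain ⟨σ₀⟩ := orderIso_preimage e hsub
  obtain ⟨σ₁⟩ := orderIso_preimage e hKM
  obtain ⟨σ⟩ := orderIso_preimage e hEM
  obtain ⟨φ₀⟩ := optOrd_fibre h0
  -- Component `0` and `K` are two copies of the shuffle of `p` inside `M`, and the components with
  -- index in `Ico 1 l` are exactly what lies between them.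
  have hC : ({z | (e z : seqOrd T) ∈ lexFst ⁻¹' Ico 1 l} : Set _) = ∅ ∨
      (∃ i, Nonempty ({z | (e z : seqOrd T) ∈ lexFst ⁻¹' Ico 1 l} ≃o (p i).toLinOrd)) ∨
      ConvexEmb (shuffle n p).toLinOrd {z | (e z : seqOrd T) ∈ lexFst ⁻¹' Ico 1 l} := by
    refine Shuffle.between_cases (A := fun i => (p i).toLinOrd) hp
      ((ordConnected_lexFst_preimage ordConnected_singleton).preimage_mono hgmono)
      (hKc.preimage_mono hgmono) (φ₀.trans σ₀.symm) ((θ.trans ψ).trans σ₁.symm)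
      ((ordConnected_lexFst_preimage ordConnected_Ico).preimage_mono hgmono) fun z => ?_
    constructor
    · intro hz
      constructor
      · intro y hy
        have h1 : lexFst (e y : seqOrd T) = 0 := hy
        have h2 : (e y : seqOrd T) < e z := lt_of_lexFst_lt (by rw [h1]; exact hz.1)
        exact e.lt_iff_lt.1 h2
      · intro y hy
        have h2 : (e z : seqOrd T) < e y := lt_of_lexFst_lt (hz.2.trans_eq (hKl hy).symm)
        exact e.lt_iff_lt.1 h2
    · rintro ⟨hz₀, hz₁⟩
      refine ⟨Nat.one_le_iff_ne_zero.2 fun h1 => lt_irrefl _ (hz₀ z h1), ?_⟩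
      by_contra hlt
      obtain ⟨k, hk⟩ := hKne
      obtain ⟨y, hy⟩ := e.surjective ⟨k, hKM hk⟩
      have hyk : (e y : seqOrd T) = k := by rw [hy]
      have hzk : (e z : seqOrd T) ≤ k := hyk ▸ e.monotone (hz₁ y (by
        change (e y : seqOrd T) ∈ K
        rw [hyk]; exact hk)).le
      refine lt_irrefl _ (hz₁ z (hKlow k hk _ hzk (le_antisymm ?_ (not_lt.1 hlt))))
      exact (lexFst_monotone hzk).trans_eq (hKl hk)
  obtain ⟨L, hL, hseg⟩ := h.exists_segment (i := 1) (k := l - 1) (t := shuffle m r) (by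
    rw [← hr]; congr 1; omega)
  have habs := h.not_absorbing 0 n p L (shuffle m r)
    ((segment_singleton.2 h0).append (l' := L ++ [shuffle m r]) (Segment.append hseg
      (segment_singleton.2 (by rw [← hr, hL]; congr 1; simp; omega)))) ⟨θ⟩
  have hLne : L ≠ [] := fun h => habs (Or.inl h)
  obtain ⟨τ⟩ := segment_orderIso hLne hseg
  have hlL : 1 + L.length = l := by omega
  rw [hlL] at τ
  rcases hC with hC | ⟨i, ⟨ρ⟩⟩ | hC
  · exact notMem_empty _ (hC.subset (σ.symm (τ (Classical.arbitrary _))).2)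
  · exact habs (Or.inr ⟨hLne, i, ⟨(τ.trans σ.symm).trans ρ⟩⟩)
  -- A further copy in between has a copy in some component before `l`, against the choice of `l`.
  · obtain ⟨k, hk⟩ := exists_convexEmb_inter_fibre (A := fun i => (p i).toLinOrd)
      (hC.congr_right σ)
    have hkl : k < l := by
      obtain ⟨f, -⟩ := hk
      have h1 := (f (Classical.arbitrary (shuffle n p).toLinOrd)).2
      have h2 := h1.1.2
      rwa [show lexFst _ = k from h1.2] at h2
    refine hmin k hkl (hk.trans (ConvexEmb.of_subset ?_ ?_))
    · exact inter_subset_inter_left _ fun x hx => ⟨hEM hx, hx.1⟩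
    · exact (ordConnected_lexFst_preimage ordConnected_Ico).inter
        (ordConnected_lexFst_preimage ordConnected_singleton)

/-! ### Matching the components of two sequences with isomorphic orders -/

variable {T S : ℕ → Option OTerm}

theorem isLowerSet_fibre_zero (T : ℕ → Option OTerm) :
    IsLowerSet (lexFst ⁻¹' {0} : Set (seqOrd T)) := fun _ _ hyx hx =>
  Nat.le_zero.1 ((lexFst_monotone hyx).trans_eq hx)

theorem compl_fibre_zero (T : ℕ → Option OTerm) :
    (lexFst ⁻¹' Ici 1 : Set (seqOrd T)) = (lexFst ⁻¹' {0})ᶜ := by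
  ext x
  exact Nat.one_le_iff_ne_zero

/-- An isomorphism that matches the first components restricts to components and tails. -/
theorem orderIso_of_image_fibre {a b : OTerm} (ha : T 0 = some a) (hb : S 0 = some b)
    (e : seqOrd T ≃o seqOrd S) (h : e '' (lexFst ⁻¹' {0}) = lexFst ⁻¹' {0}) :
    Nonempty (a.toLinOrd ≃o b.toLinOrd) ∧
      Nonempty (seqOrd (fun i => T (i + 1)) ≃o seqOrd (fun i => S (i + 1))) := by
  obtain ⟨φ⟩ := exists_orderIso_image e (lexFst ⁻¹' {0})
  obtain ⟨ψ⟩ := exists_orderIso_image e (lexFst ⁻¹' Ici 1)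
  have h' : e '' (lexFst ⁻¹' Ici 1) = lexFst ⁻¹' Ici 1 := by
    rw [compl_fibre_zero, image_compl_eq e.bijective, h, compl_fibre_zero]
  rw [h] at φ
  rw [h'] at ψ
  exact ⟨⟨((optOrd_fibre ha).some.trans φ).trans (optOrd_fibre hb).some.symm⟩,
    ⟨((tail_orderIso T).some.trans ψ).trans (tail_orderIso S).some.symm⟩⟩

theorem IsGood.eq_none (h : IsGood T) (h0 : T 0 = none) (i : ℕ) : T i = none := by
  induction i with
  | zero => exact h0
  | succ i ih => exact h.none_succ i ih

theorem IsGood.zero_ne_none (h : IsGood T) [hne : Nonempty (seqOrd T)] : T 0 ≠ none := fun h0 => by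
  obtain ⟨x⟩ := hne
  obtain ⟨t, ht⟩ := exists_some x
  rw [h.eq_none h0] at ht
  cases ht

theorem nonempty_seqOrd {a : OTerm} (h : T 0 = some a) : Nonempty (seqOrd T) :=
  ⟨((optOrd_fibre h).some (Classical.arbitrary _)).1⟩

/-- Sequences with isomorphic orders are both empty or both nonempty. -/
theorem IsGood.zero_eq_none_iff (hT : IsGood T) (hS : IsGood S) (e : seqOrd T ≃o seqOrd S) :
    T 0 = none ↔ S 0 = none := by
  constructor <;> intro h <;> by_contra h'
  · obtain ⟨b, hb⟩ := Option.ne_none_iff_exists'.1 h'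
    have := nonempty_seqOrd hb
    have : Nonempty (seqOrd T) := e.symm.toEquiv.nonempty_congr.1 this
    exact hT.zero_ne_none h
  · obtain ⟨b, hb⟩ := Option.ne_none_iff_exists'.1 h'
    have := nonempty_seqOrd hb
    have : Nonempty (seqOrd S) := e.toEquiv.nonempty_congr.1 this
    exact hS.zero_ne_none h

theorem exists_lt_of_shuffle {n : ℕ} {p : Fin (n + 1) → OTerm} {i : ℕ}
    (hi : T i = some (shuffle n p)) (x : seqOrd T) (hx : i ≤ lexFst x) :
    ∃ y < x, lexFst y = i := by
  obtain ⟨φ⟩ := optOrd_fibre hi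
  rcases hx.lt_or_eq with hx | rfl
  · refine ⟨φ (Classical.arbitrary _), lt_of_lexFst_lt ?_, (φ (Classical.arbitrary _)).2⟩
    exact lt_of_eq_of_lt (φ (Classical.arbitrary _)).2 hx
  · obtain ⟨z, hz⟩ := exists_lt (φ.symm ⟨x, rfl⟩)
    refine ⟨φ z, ?_, (φ z).2⟩
    have := φ.strictMono hz
    rw [φ.apply_symm_apply] at this
    exact this

/-- An order that begins with a shuffle has no least point, whereas a finite first component
provides one. -/
theorem IsGood.exists_shuffle_of_shuffle (hS : IsGood S) (e : seqOrd T ≃o seqOrd S)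
    {n : ℕ} {p : Fin (n + 1) → OTerm} (h0 : T 0 = some (shuffle n p)) :
    ∃ m r, S 0 = some (shuffle m r) := by
  have hne := nonempty_seqOrd h0
  have : Nonempty (seqOrd S) := e.toEquiv.nonempty_congr.1 hne
  obtain ⟨b, hb⟩ := Option.ne_none_iff_exists'.1 hS.zero_ne_none
  rcases hS.component 0 b hb with hf | ⟨m, r, rfl, -⟩
  · exfalso
    have : Finite b.toLinOrd := hf
    obtain ⟨φ⟩ := optOrd_fibre hb
    obtain ⟨x, hx⟩ := Finite.exists_min (id : b.toLinOrd → b.toLinOrd)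
    obtain ⟨y, hy, -⟩ := exists_lt_of_shuffle h0 (e.symm (φ x)) (Nat.zero_le _)
    have hey : e y < φ x := by
      have := e.strictMono hy
      rwa [e.apply_symm_apply] at this
    have hy0 : e y ∈ lexFst ⁻¹' {0} := isLowerSet_fibre_zero S hey.le (φ x).2
    have h1 := φ.monotone (hx (φ.symm ⟨e y, hy0⟩))
    simp only [id, φ.apply_symm_apply] at h1
    exact not_lt.2 h1 hey
  · exact ⟨m, r, hb⟩

/-- The image is an initial segment of the leading shuffle of `S`, so self-similarity makes the two
leading shuffles embed in each other and hence isomorphic. The preimage of the first component of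
`S` is then an initial segment of the type of the first component of `T`, and `IsGood.eq_fibre`
applies. -/
theorem IsGood.image_fibre_of_subset (hT : IsGood T) (hS : IsGood S) (e : seqOrd T ≃o seqOrd S)
    {n : ℕ} {p : Fin (n + 1) → OTerm} (h0 : T 0 = some (shuffle n p))
    {m : ℕ} {r : Fin (m + 1) → OTerm} (h0' : S 0 = some (shuffle m r))
    (hsub : e '' (lexFst ⁻¹' {0}) ⊆ lexFst ⁻¹' {0}) :
    e '' (lexFst ⁻¹' {0}) = lexFst ⁻¹' {0} := by
  obtain ⟨φ⟩ := optOrd_fibre h0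
  obtain ⟨ψ⟩ := optOrd_fibre h0'
  obtain ⟨χ⟩ := exists_orderIso_image e (lexFst ⁻¹' {0})
  have hlow : IsLowerSet (e '' (lexFst ⁻¹' {0})) := by
    rw [e.image_eq_preimage_symm]
    exact (isLowerSet_fibre_zero T).preimage e.symm.monotone
  have hpr : ConvexEmb (shuffle n p).toLinOrd (shuffle m r).toLinOrd :=
    ((ConvexEmb.of_subset hsub hlow.ordConnected).congr_left (φ.trans χ).symm).congr_right ψ.symm
  have hrp : ConvexEmb (shuffle m r).toLinOrd (shuffle n p).toLinOrd := by
    have hss : Shuffle.SelfSimilar (lexFst ⁻¹' {0} : Set (seqOrd S)) :=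
      Shuffle.SelfSimilar.congr ψ (Shuffle.selfSimilar (A := fun i => (r i).toLinOrd))
    have h1 := hss (Subtype.val ⁻¹' (e '' (lexFst ⁻¹' {0})))
      (Or.inl fun a b hba ha => hlow hba ha)
      ⟨⟨(χ (φ (Classical.arbitrary _))).1, hsub (χ (φ (Classical.arbitrary _))).2⟩,
        (χ (φ (Classical.arbitrary _))).2⟩
    exact ((h1.congr_right (orderIso_preimage_val hsub).some).congr_left ψ.symm).congr_right
      (φ.trans χ).symm
  obtain ⟨θ⟩ := (hS.tight h0').of_convexEmb hpr hrp
  obtain ⟨ω⟩ := exists_orderIso_image e.symm (lexFst ⁻¹' {0})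
  have hM := hT.eq_fibre h0 (M := e.symm '' (lexFst ⁻¹' {0})) (by
      rw [e.symm.image_eq_preimage_symm]
      exact (isLowerSet_fibre_zero S).preimage e.monotone)
    (fun x hx => ⟨e x, hsub ⟨x, hx, rfl⟩, e.symm_apply_apply x⟩) ((θ.trans ψ).trans ω)
  rw [← hM, ← image_comp]
  simp

/-- Initial segments are comparable, so one of `e` and `e.symm` falls under the preceding lemma. -/
theorem IsGood.image_fibre (hT : IsGood T) (hS : IsGood S) (e : seqOrd T ≃o seqOrd S)
    {n : ℕ} {p : Fin (n + 1) → OTerm} (h0 : T 0 = some (shuffle n p)) :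
    e '' (lexFst ⁻¹' {0}) = lexFst ⁻¹' {0} := by
  obtain ⟨m, r, h0'⟩ := hS.exists_shuffle_of_shuffle e h0
  have hlow : IsLowerSet (e '' (lexFst ⁻¹' {0})) := by
    rw [e.image_eq_preimage_symm]
    exact (isLowerSet_fibre_zero T).preimage e.symm.monotone
  rcases hlow.total (isLowerSet_fibre_zero S) with h | h
  · exact hT.image_fibre_of_subset hS e h0 h0' h
  · have h1 := hS.image_fibre_of_subset hT e.symm h0' h0 (by
      rintro _ ⟨x, hx, rfl⟩
      obtain ⟨y, hy, rfl⟩ := h hx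
      rwa [e.symm_apply_apply])
    rw [← h1, ← image_comp]
    simp

theorem image_fibre_of_ncard_eq (e : seqOrd T ≃o seqOrd S)
    (hT : (lexFst ⁻¹' {0} : Set (seqOrd T)).Finite) (hS : (lexFst ⁻¹' {0} : Set (seqOrd S)).Finite)
    (h : (lexFst ⁻¹' {0} : Set (seqOrd T)).ncard = (lexFst ⁻¹' {0} : Set (seqOrd S)).ncard) :
    e '' (lexFst ⁻¹' {0}) = lexFst ⁻¹' {0} := by
  have hlow : IsLowerSet (e '' (lexFst ⁻¹' {0})) := by
    rw [e.image_eq_preimage_symm]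
    exact (isLowerSet_fibre_zero T).preimage e.symm.monotone
  have hcard : (e '' (lexFst ⁻¹' {0})).ncard = (lexFst ⁻¹' {0} : Set (seqOrd S)).ncard := by
    rw [ncard_image_of_injective _ e.injective, h]
  rcases hlow.total (isLowerSet_fibre_zero S) with h | h
  · exact eq_of_subset_of_ncard_le h hcard.ge hS
  · exact (eq_of_subset_of_ncard_le h hcard.le (hT.image _)).symm

theorem finite_fibre {a : OTerm} {i : ℕ} (ha : T i = some a) (hf : a.IsFinite) :
    (lexFst ⁻¹' {i} : Set (seqOrd T)).Finite := by
  have : Finite a.toLinOrd := hf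
  exact Finite.of_equiv _ (optOrd_fibre ha).some.toEquiv

theorem ncard_fibre_one {i : ℕ} (h : T i = some one) :
    (lexFst ⁻¹' {i} : Set (seqOrd T)).ncard = 1 := by
  rw [← Nat.card_coe_set_eq, ← Nat.card_congr (optOrd_fibre h).some.toEquiv]
  exact Nat.card_unique (α := Unit)

theorem isFinite_one : one.IsFinite := inferInstanceAs (Finite Unit)

/-- A good sequence in which a finite component is followed by an infinite one, or all further
components are singletons. -/
structure IsReduced (T : ℕ → Option OTerm) : Prop extends IsGood T where
  finite_next : ∀ i a b, T i = some a → T (i + 1) = some b → a.IsFinite →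
    ¬ b.IsFinite ∨ ∀ k, i ≤ k → T k = some one

theorem IsReduced.tail (h : IsReduced T) : IsReduced fun i => T (i + 1) where
  toIsGood := h.toIsGood.tail
  finite_next i a b ha hb hf := (h.finite_next (i + 1) a b ha hb hf).imp_right
    fun h k hk => h (k + 1) (Nat.succ_le_succ hk)

/-- A finite `Iic y` would give the tail a least point. -/
theorem infinite_Iic_of_tail (h : ∀ y : seqOrd T, 1 ≤ lexFst y → ∃ z < y, 1 ≤ lexFst z)
    {y : seqOrd T} (hy : 1 ≤ lexFst y) : (Iic y).Infinite := fun hfin => by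
  obtain ⟨z, hz, hmin⟩ := (hfin.inter_of_left (lexFst ⁻¹' Ici 1)).exists_minimal ⟨y, self_mem_Iic, hy⟩
  obtain ⟨w, hw, hw1⟩ := h z hz.2
  exact not_lt.2 (hmin ⟨hw.le.trans hz.1, hw1⟩ hw.le) hw

/-- Unless all entries are `one`, a second entry must be a shuffle, which has no least point; if
there is no second entry, the first alternative is vacuous. -/
theorem IsReduced.tail_cases (h : IsReduced T) {a : OTerm} (ha : T 0 = some a) (hf : a.IsFinite) :
    (∀ y : seqOrd T, 1 ≤ lexFst y → ∃ z < y, 1 ≤ lexFst z) ∨ ∀ k, T k = some one := by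
  by_cases hall : ∀ k, T k = some one
  · exact Or.inr hall
  · refine Or.inl fun y hy => ?_
    obtain ⟨t, ht⟩ := exists_some y
    obtain ⟨b, hb⟩ : ∃ b, T 1 = some b := by
      obtain ⟨l, hl, hs⟩ := h.exists_segment (i := 0) (k := lexFst y) (t := t) (by rwa [zero_add])
      rcases hy.lt_or_eq with hy | hy
      · exact ⟨_, hs 1 (by omega)⟩
      · exact ⟨t, hy ▸ ht⟩
    rcases h.component 1 b hb with hbf | ⟨n, p, rfl, -⟩
    · rcases h.finite_next 0 a b ha hb hf with h1 | h1
      · exact absurd hbf h1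
      · exact absurd (fun k => h1 k (Nat.zero_le k)) hall
    · obtain ⟨z, hz, hz1⟩ := exists_lt_of_shuffle hb y hy
      exact ⟨z, hz, hz1.ge⟩

theorem finite_Iic_of_ones (h : ∀ k, T k = some one) (x : seqOrd T) : (Iic x).Finite := by
  refine ((finite_Iic (lexFst x)).biUnion fun k _ => finite_fibre (h k) isFinite_one).subset ?_
  intro y hy
  exact mem_biUnion (x := lexFst y) (lexFst_monotone hy) rfl

theorem infinite_of_ones (h : ∀ k, T k = some one) : Infinite (seqOrd T) :=
  Infinite.of_surjective (lexFst : seqOrd T → ℕ) fun k =>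
    ⟨((optOrd_fibre (h k)).some (Classical.arbitrary _)).1,
      ((optOrd_fibre (h k)).some (Classical.arbitrary _)).2⟩

/-- Points of a finite first component have finitely many predecessors, points of the tail of `S`
infinitely many. -/
theorem image_fibre_subset_of_tail (e : seqOrd T ≃o seqOrd S)
    (h : ∀ y : seqOrd S, 1 ≤ lexFst y → ∃ z < y, 1 ≤ lexFst z)
    (hT : (lexFst ⁻¹' {0} : Set (seqOrd T)).Finite) :
    e '' (lexFst ⁻¹' {0}) ⊆ lexFst ⁻¹' {0} := by
  rintro _ ⟨x, hx, rfl⟩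
  by_contra hne
  refine infinite_Iic_of_tail h (Nat.one_le_iff_ne_zero.2 hne) ((hT.image e).subset ?_)
  intro y hy
  refine ⟨e.symm y, isLowerSet_fibre_zero T ?_ hx, e.apply_symm_apply y⟩
  rw [← e.symm_apply_apply x]
  exact e.symm.monotone hy

theorem false_of_ones (e : seqOrd T ≃o seqOrd S) (hT : ∀ k, T k = some one)
    (h : ∀ y : seqOrd S, 1 ≤ lexFst y → ∃ z < y, 1 ≤ lexFst z)
    (hS : (lexFst ⁻¹' {0} : Set (seqOrd S)).Finite) : False := by
  have := infinite_of_ones hT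
  have : Infinite (seqOrd S) := Infinite.of_injective e e.injective
  obtain ⟨z, hz⟩ := hS.exists_notMem
  refine infinite_Iic_of_tail h (Nat.one_le_iff_ne_zero.2 hz)
    (((finite_Iic_of_ones hT (e.symm z)).image e).subset fun y hy => ?_)
  exact ⟨e.symm y, e.symm.monotone hy, e.apply_symm_apply y⟩

theorem IsReduced.image_fibre (hT : IsReduced T) (hS : IsReduced S) (e : seqOrd T ≃o seqOrd S)
    {a : OTerm} (ha : T 0 = some a) : e '' (lexFst ⁻¹' {0}) = lexFst ⁻¹' {0} := by
  have : Nonempty (seqOrd S) := e.toEquiv.nonempty_congr.1 (nonempty_seqOrd ha)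
  obtain ⟨b, hb⟩ := Option.ne_none_iff_exists'.1 hS.zero_ne_none
  rcases hT.component 0 a ha with hfa | ⟨n, p, rfl, -⟩
  · rcases hS.component 0 b hb with hfb | ⟨m, r, rfl, -⟩
    · have hFa := finite_fibre ha hfa
      -- Two tails without least point give both inclusions; two sequences of singletons are matched
      -- by counting. In the mixed cases one order is of type `ω`, while the other has points with
      -- infinitely many predecessors.
      have hFb := finite_fibre hb hfb
      rcases hT.tail_cases ha hfa with h1 | h1 <;> rcases hS.tail_cases hb hfb with h2 | h2
      · refine (image_fibre_subset_of_tail e h2 hFa).antisymm fun x hx => ?_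
        exact ⟨e.symm x, image_fibre_subset_of_tail e.symm h1 hFb ⟨x, hx, rfl⟩,
          e.apply_symm_apply x⟩
      · exact (false_of_ones e.symm h2 h1 hFa).elim
      · exact (false_of_ones e h1 h2 hFb).elim
      · exact image_fibre_of_ncard_eq e hFa hFb
          ((ncard_fibre_one (h1 0)).trans (ncard_fibre_one (h2 0)).symm)
    · obtain ⟨n, p, h⟩ := hT.exists_shuffle_of_shuffle e.symm hb
      rw [ha] at h
      cases h
      exact absurd hfa (not_isFinite_shuffle p)
  · exact hT.toIsGood.image_fibre hS.toIsGood e ha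

/-- The components of a reduced sequence are determined up to isomorphism by its order. -/
theorem IsReduced.unique (hT : IsReduced T) (hS : IsReduced S) (e : seqOrd T ≃o seqOrd S) (j : ℕ) :
    (T j = none ↔ S j = none) ∧
      ∀ a b, T j = some a → S j = some b → Nonempty (a.toLinOrd ≃o b.toLinOrd) := by
  induction j generalizing T S with
  | zero =>
    refine ⟨hT.zero_eq_none_iff hS.toIsGood e, fun a b ha hb => ?_⟩
    exact (orderIso_of_image_fibre ha hb e (hT.image_fibre hS e ha)).1
  | succ j ih =>
    cases ha : T 0 with
    | none =>
      have hb := (hT.zero_eq_none_iff hS.toIsGood e).1 ha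
      rw [hT.eq_none ha, hS.eq_none hb]
      simp
    | some a =>
      have h' : S 0 ≠ none := fun h => by
        rw [(hT.zero_eq_none_iff hS.toIsGood e).2 h] at ha
        cases ha
      obtain ⟨b, hb⟩ := Option.ne_none_iff_exists'.1 h'
      obtain ⟨e'⟩ := (orderIso_of_image_fibre ha hb e (hT.image_fibre hS e ha)).2
      exact ih hT.tail hS.tail e'

/-- The components of a good list of singletons and shuffles are determined up to isomorphism by
its order. -/
theorem IsGood.forall₂_orderIso {l l' : List OTerm} (hl : ∀ a ∈ l, a = one ∨ a.IsShuffle)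
    (hl' : ∀ a ∈ l', a = one ∨ a.IsShuffle) (h : IsGood fun i => l[i]?)
    (h' : IsGood fun i => l'[i]?)
    (e : seqOrd (fun i => l[i]?) ≃o seqOrd (fun i => l'[i]?)) :
    List.Forall₂ (fun a b : OTerm => Nonempty (a.toLinOrd ≃o b.toLinOrd)) l l' := by
  induction l generalizing l' with
  | nil =>
    have := (h.zero_eq_none_iff h' e).1 rfl
    obtain rfl : l' = [] := by
      cases l' with
      | nil => rfl
      | cons => simp at this
    exact List.Forall₂.nil
  | cons a l ih =>
    cases l' with
    | nil =>
      have := (h.zero_eq_none_iff h' e).2 rfl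
      simp at this
    | cons b l' =>
      have ha : (fun i => (a :: l)[i]?) 0 = some a := rfl
      have hb : (fun i => (b :: l')[i]?) 0 = some b := rfl
      -- The finite entries are single points here, so counting suffices and no condition on
      -- successive finite entries is needed.
      have himage : e '' (lexFst ⁻¹' {0}) = lexFst ⁻¹' {0} := by
        rcases hl a List.mem_cons_self with rfl | ⟨n, p, rfl⟩
        · rcases hl' b List.mem_cons_self with rfl | ⟨n, p, rfl⟩
          · exact image_fibre_of_ncard_eq e (finite_fibre ha isFinite_one)
              (finite_fibre hb isFinite_one) ((ncard_fibre_one ha).trans (ncard_fibre_one hb).symm)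
          · obtain ⟨m, r, h1⟩ := h.exists_shuffle_of_shuffle e.symm hb
            cases h1
        · exact h.image_fibre h' e ha
      obtain ⟨h1, ⟨e'⟩⟩ := orderIso_of_image_fibre ha hb e himage
      exact List.Forall₂.cons h1 (ih (fun c hc => hl c (List.mem_cons_of_mem _ hc))
        (fun c hc => hl' c (List.mem_cons_of_mem _ hc)) h.tail h'.tail e')

/-! ### Components of terms -/

theorem mem_atoms {t a : OTerm} (h : a ∈ t.atoms) : a = one ∨ a.IsShuffle := by
  induction t with
  | one => exact Or.inl (List.mem_singleton.1 h)
  | concat s t ihs iht => exact (List.mem_append.1 h).elim ihs iht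
  | shuffle n p => exact Or.inr ⟨n, p, List.mem_singleton.1 h⟩

theorem atoms_ne_nil (t : OTerm) : t.atoms ≠ [] := by
  induction t with
  | one => simp [atoms]
  | concat s t ihs iht => simp [atoms, ihs]
  | shuffle n p => simp [atoms]

theorem IsNormal.of_mem_atoms {t a : OTerm} (ht : t.IsNormal) (h : a ∈ t.atoms) : a.IsNormal := by
  induction t with
  | one => rwa [List.mem_singleton.1 h]
  | concat s t ihs iht => exact (List.mem_append.1 h).elim (ihs ht.1) (iht ht.2.1)
  | shuffle n p => rwa [List.mem_singleton.1 h]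

theorem IsAbsorbing.two_le_length {l : List OTerm} (h : IsAbsorbing l) : 2 ≤ l.length := by
  obtain ⟨n, p, m, P, rfl, -⟩ := h
  simp

theorem IsNormal.not_isAbsorbing {t : OTerm} (ht : t.IsNormal) {l : List OTerm}
    (hl : l <:+: t.atoms) : ¬ IsAbsorbing l := by
  cases t with
  | one => exact fun h => absurd (h.two_le_length.trans hl.length_le) (by simp [atoms])
  | concat s t => exact ht.2.2 l hl
  | shuffle n p => exact fun h => absurd (h.two_le_length.trans hl.length_le) (by simp [atoms])

theorem atoms_cat {l : List OTerm} (hl : l ≠ []) : (cat l).atoms = l.flatMap atoms := by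
  induction l using List.reverseRecOn with
  | nil => exact absurd rfl hl
  | append_singleton l b ih =>
    rcases eq_or_ne l [] with rfl | hl
    · simp [cat]
    · rw [cat_append_singleton hl]
      simp [atoms, ih hl]

theorem isNormal_cat {l : List OTerm} (hl : ∀ a ∈ l, IsNormal a)
    (h : ∀ m, m <:+: l.flatMap atoms → ¬ IsAbsorbing m) : (cat l).IsNormal := by
  induction l using List.reverseRecOn with
  | nil => trivial
  | append_singleton l b ih =>
    rcases eq_or_ne l [] with rfl | hne
    · exact hl b (by simp)
    · rw [cat_append_singleton hne]
      refine ⟨ih (fun a ha => hl a (List.mem_append_left _ ha)) fun m hm => h m ?_,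
        hl b (by simp), fun m hm => h m ?_⟩
      · rw [List.flatMap_append]
        exact hm.trans (List.prefix_append _ _).isInfix
      · rwa [← cat_append_singleton hne, atoms_cat (by simp)] at hm

theorem flatMap_atoms {l : List OTerm} (hl : ∀ a ∈ l, a = one ∨ a.IsShuffle) :
    l.flatMap atoms = l := by
  induction l with
  | nil => rfl
  | cons a l ih =>
    rw [List.flatMap_cons, ih fun b hb => hl b (List.mem_cons_of_mem _ hb)]
    rcases hl a List.mem_cons_self with rfl | ⟨n, p, rfl⟩ <;> rfl

theorem same_cat_append {l l' : List OTerm} (hl : l ≠ []) (hl' : l' ≠ []) :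
    Same (cat (l ++ l')) (concat (cat l) (cat l')) := by
  induction l' using List.reverseRecOn with
  | nil => exact absurd rfl hl'
  | append_singleton l' b ih =>
    rcases eq_or_ne l' [] with rfl | hne
    · rw [List.nil_append, cat_append_singleton hl]
      exact Same.refl _
    · rw [← List.append_assoc, cat_append_singleton (by simp [hl]), cat_append_singleton hne]
      exact (Same.concat (ih hne) (Same.refl b)).trans (Same.assoc _ _ _)

theorem same_cat_atoms (t : OTerm) : Same (cat t.atoms) t := by
  induction t with
  | one => exact Same.refl _
  | concat s t ihs iht =>
    exact (same_cat_append s.atoms_ne_nil t.atoms_ne_nil).trans (Same.concat ihs iht)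
  | shuffle n p => exact Same.refl _

theorem same_cat_of_forall₂ {l l' : List OTerm} (h : List.Forall₂ Same l l') :
    Same (cat l) (cat l') := by
  have key : ∀ {l l' : List OTerm}, List.Forall₂ Same l l' → ∀ a b, Same a b →
      Same (l.foldl concat a) (l'.foldl concat b) := by
    intro l l' h
    induction h with
    | nil => exact fun _ _ h => h
    | cons h _ ih => exact fun a b hab => ih _ _ (Same.concat hab h)
  cases h with
  | nil => exact Same.refl _
  | cons h hl => exact key hl _ _ h

theorem cat_orderIso {l : List OTerm} (hl : l ≠ []) :
    Nonempty ((cat l).toLinOrd ≃o seqOrd fun i => l[i]?) := by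
  obtain ⟨φ⟩ := segment_orderIso (T := fun i => l[i]?) (i := 0) hl fun k hk => by
    rw [zero_add]; exact List.getElem?_eq_getElem hk
  have : (lexFst ⁻¹' Ico 0 (0 + l.length) : Set (seqOrd fun i => l[i]?)) = univ := by
    refine eq_univ_of_forall fun x => ⟨Nat.zero_le _, ?_⟩
    obtain ⟨t, ht⟩ := exists_some x
    rw [zero_add]
    exact (List.getElem?_eq_some_iff.1 ht).1
  rw [this] at φ
  exact ⟨φ.trans OrderIso.Set.univ⟩

theorem atoms_orderIso (t : OTerm) : Nonempty (t.toLinOrd ≃o seqOrd fun i => t.atoms[i]?) :=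
  ⟨(same_cat_atoms t).orderIso.some.symm.trans (cat_orderIso t.atoms_ne_nil).some⟩

theorem convexEmb_cat_of_mem {l : List OTerm} {a : OTerm} (h : a ∈ l) :
    ConvexEmb a.toLinOrd (cat l).toLinOrd := by
  obtain ⟨i, hi, rfl⟩ := List.getElem_of_mem h
  have hi' : (fun i => l[i]?) i = some l[i] := List.getElem?_eq_getElem hi
  exact ((ConvexEmb.of_set (ordConnected_lexFst_preimage ordConnected_singleton)).congr_left
    (optOrd_fibre hi').some.symm).congr_right (cat_orderIso (List.ne_nil_of_mem h)).some.symm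

theorem convexEmb_of_mem_atoms {t a : OTerm} (h : a ∈ t.atoms) :
    ConvexEmb a.toLinOrd t.toLinOrd :=
  (convexEmb_cat_of_mem h).congr_right (same_cat_atoms t).orderIso.some

theorem convexEmb_shuffle {n : ℕ} (p : Fin (n + 1) → OTerm) (i : Fin (n + 1)) :
    ConvexEmb (p i).toLinOrd (shuffle n p).toLinOrd :=
  Shuffle.colour_convexEmb (fun i => (p i).toLinOrd) i

/-! ### Rank and size -/

/-- The nesting depth of shuffles in a term. -/
def rank : OTerm → ℕ
  | one => 0
  | concat s t => max s.rank t.rank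
  | shuffle _ p => (Finset.univ.sup fun i => (p i).rank) + 1

/-- The number of singletons and shuffles in a term. -/
def size : OTerm → ℕ
  | one => 1
  | concat s t => s.size + t.size
  | shuffle _ p => (∑ i, (p i).size) + 1

theorem rank_lt {n : ℕ} (p : Fin (n + 1) → OTerm) (i : Fin (n + 1)) :
    (p i).rank < (shuffle n p).rank :=
  Nat.lt_succ_of_le (Finset.le_sup (f := fun i => (p i).rank) (Finset.mem_univ i))

theorem size_lt {n : ℕ} (p : Fin (n + 1) → OTerm) (i : Fin (n + 1)) :
    (p i).size < (shuffle n p).size :=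
  Nat.lt_succ_of_le (Finset.single_le_sum (f := fun i => (p i).size) (fun _ _ => Nat.zero_le _)
    (Finset.mem_univ i))

theorem rank_le_of_mem_atoms {t a : OTerm} (h : a ∈ t.atoms) : a.rank ≤ t.rank := by
  induction t with
  | one => rw [List.mem_singleton.1 h]
  | concat s t ihs iht =>
    exact (List.mem_append.1 h).elim (fun h => (ihs h).trans (le_max_left _ _))
      (fun h => (iht h).trans (le_max_right _ _))
  | shuffle n p => rw [List.mem_singleton.1 h]

theorem rank_cat_le {l : List OTerm} {N : ℕ} (h : ∀ a ∈ l, a.rank ≤ N) : (cat l).rank ≤ N := by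
  induction l using List.reverseRecOn with
  | nil => exact Nat.zero_le _
  | append_singleton l b ih =>
    rcases eq_or_ne l [] with rfl | hne
    · exact h b (by simp)
    · rw [cat_append_singleton hne]
      exact max_le (ih fun a ha => h a (List.mem_append_left _ ha)) (h b (by simp))

theorem sum_size_atoms (t : OTerm) : (t.atoms.map size).sum = t.size := by
  induction t with
  | one => rfl
  | concat s t ihs iht => simp [atoms, size, ihs, iht]
  | shuffle n p => simp [atoms]

theorem size_cat {l : List OTerm} (hl : l ≠ []) : (cat l).size = (l.map size).sum := by
  induction l using List.reverseRecOn with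
  | nil => exact absurd rfl hl
  | append_singleton l b ih =>
    rcases eq_or_ne l [] with rfl | hne
    · simp [cat]
    · rw [cat_append_singleton hne]
      simp [size, ih hne]

theorem size_pos (t : OTerm) : 0 < t.size := by
  induction t with
  | one => exact Nat.one_pos
  | concat s t ihs _ => exact Nat.add_pos_left ihs _
  | shuffle n p => exact Nat.succ_pos _

theorem size_le_of_mem_atoms {t a : OTerm} (h : a ∈ t.atoms) : a.size ≤ t.size := by
  rw [← sum_size_atoms t]
  exact List.single_le_sum (fun _ _ => Nat.zero_le _) _ (List.mem_map_of_mem h)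

theorem sum_size_le_of_infix {l l' : List OTerm} (h : l <:+: l') :
    (l.map size).sum ≤ (l'.map size).sum := by
  obtain ⟨s, t, rfl⟩ := h
  simp only [List.map_append, List.sum_append]
  omega

/-! ### Isomorphic shuffles -/

theorem convexEmb_flank {n : ℕ} {A : Fin (n + 1) → Type} [∀ i, LinearOrder (A i)]
    (o₀ o₁ : Option (Fin (n + 1))) : ConvexEmb (Shuffle A) (Shuffle.Flank A o₀ o₁) := by
  have hr : ConvexEmb (Shuffle A) (OptOrd A o₀ ⊕ₗ Shuffle A) := by
    refine ⟨⟨⟨fun x => toLex (Sum.inr x), fun x y h => Sum.inr_injective h⟩,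
      Sum.Lex.inr_le_inr_iff⟩, ⟨?_⟩⟩
    rintro _ ⟨x, rfl⟩ _ ⟨y, rfl⟩ (z | z) ⟨hz, -⟩
    · exact absurd hz Sum.Lex.not_inr_le_inl
    · exact ⟨z, rfl⟩
  refine hr.trans ⟨⟨⟨fun x => toLex (Sum.inl x), fun x y h => Sum.inl_injective h⟩,
    Sum.Lex.inl_le_inl_iff⟩, ⟨?_⟩⟩
  rintro _ ⟨x, rfl⟩ _ ⟨y, rfl⟩ (z | z) ⟨-, hz⟩
  · exact ⟨z, rfl⟩
  · exact absurd hz Sum.Lex.not_inr_le_inl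

/-- In the other case of `Shuffle.block_cases`, `p i` would contain a copy of the shuffle of `r`,
hence of `p`. -/
theorem Tight.exists_orderIso {n m : ℕ} {p : Fin (n + 1) → OTerm} {r : Fin (m + 1) → OTerm}
    (hp : Tight p) (hr : Tight r) (e : (shuffle n p).toLinOrd ≃o (shuffle m r).toLinOrd)
    (i : Fin (n + 1)) : ∃ j, Nonempty ((p i).toLinOrd ≃o (r j).toLinOrd) := by
  rcases Shuffle.block_cases (A := fun i => (p i).toLinOrd) (B := fun i => (r i).toLinOrd) e hr i
    with h | ⟨o₀, o₁, ⟨φ⟩⟩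
  · exact h
  · exact absurd (((convexEmb_flank o₀ o₁).congr_right φ.symm).congr_left
      (B := (shuffle n p).toLinOrd) e.symm) (hp i)

/-- Isomorphic tight shuffles without repeated arguments have the same arguments, if the arguments
are determined by their orders. -/
theorem Tight.same {n m : ℕ} {p : Fin (n + 1) → OTerm} {r : Fin (m + 1) → OTerm}
    (hp : Tight p) (hr : Tight r) (hp' : ¬ HasRepeat p) (hr' : ¬ HasRepeat r)
    (e : (shuffle n p).toLinOrd ≃o (shuffle m r).toLinOrd)
    (h : ∀ i j, Nonempty ((p i).toLinOrd ≃o (r j).toLinOrd) → Same (p i) (r j)) :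
    Same (shuffle n p) (shuffle m r) := by
  have h₁ : ∀ i, ∃ j, Same (p i) (r j) := fun i =>
    (hp.exists_orderIso hr e i).imp fun j hj => h i j hj
  have h₂ : ∀ j, ∃ i, Same (p i) (r j) := fun j =>
    (hr.exists_orderIso hp e.symm j).imp fun i hi => h i j ⟨hi.some.symm⟩
  choose f hf using h₁
  -- Injectivity holds because `p` has no repeats. For surjectivity, `r j` is the same as some `p
  -- i`, whose match can only be `r j` as `r` has no repeats.
  have hinj : Function.Injective f := fun i i' hii' => by
    by_contra hne
    exact hp' ⟨i, i', hne, (hf i).trans (hii' ▸ (hf i').symm)⟩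
  have hsurj : Function.Surjective f := fun j => by
    obtain ⟨i, hi⟩ := h₂ j
    refine ⟨i, ?_⟩
    by_contra hne
    exact hr' ⟨f i, j, hne, (hf i).symm.trans hi⟩
  exact Same.shuffle (Equiv.ofBijective f ⟨hinj, hsurj⟩) hf

/-! ### Uniqueness of normal forms of terms -/

/-- Normal terms up to rank `N` with total size less than `K` are determined by their orders. -/
def UniqueBelow (N K : ℕ) : Prop :=
  ∀ s t : OTerm, s.IsNormal → t.IsNormal → s.rank ≤ N → t.rank ≤ N → s.size + t.size < K →
    Nonempty (s.toLinOrd ≃o t.toLinOrd) → Same s t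

/-- All normal shuffles up to rank `N` are tight. -/
def TightUpTo (N : ℕ) : Prop :=
  ∀ (n : ℕ) (p : Fin (n + 1) → OTerm), (shuffle n p).IsNormal → (shuffle n p).rank ≤ N → Tight p

theorem not_orderIso_one {n : ℕ} {p : Fin (n + 1) → OTerm} :
    ¬ Nonempty (one.toLinOrd ≃o (shuffle n p).toLinOrd) := fun ⟨e⟩ =>
  not_isFinite_shuffle p (have : Finite one.toLinOrd := isFinite_one; Finite.of_equiv _ e.toEquiv)

/-- The total size may be equal to `K`, because the comparison passes to the strictly smaller
arguments of the shuffles. -/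
theorem UniqueBelow.same_atoms {N K : ℕ} (hU : UniqueBelow N K) (hB : TightUpTo N) {a b : OTerm}
    (ha : a = one ∨ a.IsShuffle) (hb : b = one ∨ b.IsShuffle) (han : a.IsNormal) (hbn : b.IsNormal)
    (har : a.rank ≤ N) (hbr : b.rank ≤ N) (hs : a.size + b.size ≤ K)
    (e : Nonempty (a.toLinOrd ≃o b.toLinOrd)) : Same a b := by
  rcases ha with rfl | ⟨n, p, rfl⟩ <;> rcases hb with rfl | ⟨m, r, rfl⟩
  · exact Same.refl _
  · exact absurd e not_orderIso_one
  · exact absurd ⟨e.some.symm⟩ not_orderIso_one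
  · refine (hB n p han har).same (hB m r hbn hbr) han.2.1 hbn.2.1 e.some fun i j hij =>
      hU _ _ (han.1 i) (hbn.1 j) ((rank_lt p i).le.trans har) ((rank_lt r j).le.trans hbr) ?_ hij
    have := size_lt p i
    have := size_lt r j
    omega

theorem infix_of_segment {l m : List OTerm} {i : ℕ} (hm : m ≠ [])
    (h : Segment (fun i => l[i]?) i m) : m <:+: l := by
  refine ⟨l.take i, l.drop (i + m.length), ?_⟩
  have hlast : i + (m.length - 1) < l.length := by
    have h0 := List.length_pos_iff.2 hm
    exact (List.getElem?_eq_some_iff.1 (h (m.length - 1) (by omega))).1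
  have hm' : m = (l.drop i).take m.length := by
    refine List.ext_getElem? fun k => ?_
    rcases lt_or_ge k m.length with hk | hk
    · rw [List.getElem?_take_of_lt hk, List.getElem?_drop, List.getElem?_eq_getElem hk]
      exact (h k hk).symm
    · rw [List.getElem?_eq_none hk, List.getElem?_eq_none (by simp; omega)]
  calc l.take i ++ m ++ l.drop (i + m.length)
      = l.take i ++ ((l.drop i).take m.length ++ (l.drop i).drop m.length) := by
        rw [← hm', List.drop_drop, List.append_assoc]
    _ = l := by rw [List.take_append_drop, List.take_append_drop]

/-- Goodness speaks of isomorphisms and normal form of `Same`; `hU` converts one into the other. The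
sizes permit this because the two shuffles and the terms between them are separate parts of `t`, and
`p j` is smaller than its shuffle. -/
theorem UniqueBelow.isGood_atoms {N K : ℕ} (hU : UniqueBelow N K) (hB : TightUpTo N) {t : OTerm}
    (ht : t.IsNormal) (hr : t.rank ≤ N) (hs : t.size ≤ K) : IsGood fun i => t.atoms[i]? where
  none_succ i hi := by
    rw [List.getElem?_eq_none_iff] at hi ⊢
    omega
  component i a ha := by
    have ha := List.mem_of_getElem? ha
    rcases mem_atoms ha with rfl | ⟨n, p, rfl⟩
    · exact Or.inl isFinite_one
    · exact Or.inr ⟨n, p, rfl, hB n p (ht.of_mem_atoms ha) ((rank_le_of_mem_atoms ha).trans hr)⟩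
  not_absorbing i n p m P hseg e hm := by
    have hinf := infix_of_segment (by simp) hseg
    have hsize := sum_size_le_of_infix hinf
    rw [sum_size_atoms] at hsize
    simp only [List.map_cons, List.map_append, List.sum_cons, List.sum_append, List.map_nil,
      List.sum_nil] at hsize
    have hmem : ∀ b ∈ shuffle n p :: (m ++ [P]), b ∈ t.atoms := fun b hb => hinf.subset hb
    have ha := hmem _ List.mem_cons_self
    have hP := hmem P (by simp)
    have hmm : ∀ b ∈ m, b ∈ t.atoms := fun b hb => hmem b (by simp [hb])
    have hsame := hU.same_atoms hB (mem_atoms ha) (mem_atoms hP) (ht.of_mem_atoms ha)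
      (ht.of_mem_atoms hP) ((rank_le_of_mem_atoms ha).trans hr)
      ((rank_le_of_mem_atoms hP).trans hr) (by omega) e
    refine ht.not_isAbsorbing hinf ⟨n, p, m, P, rfl, hsame, hm.imp_right ?_⟩
    rintro ⟨hne, j, hj⟩
    refine ⟨j, isConcat_iff.2 ⟨hne, ?_⟩⟩
    have hj' := size_lt p j
    refine hU _ _ (isNormal_cat (fun b hb => ht.of_mem_atoms (hmm b hb)) fun l hl => ?_)
      ((ht.of_mem_atoms ha).1 j)
      (rank_cat_le fun b hb => (rank_le_of_mem_atoms (hmm b hb)).trans hr)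
      ((rank_lt p j).le.trans ((rank_le_of_mem_atoms ha).trans hr)) ?_ hj
    · rw [flatMap_atoms fun b hb => mem_atoms (hmm b hb)] at hl
      refine ht.not_isAbsorbing (hl.trans (List.IsInfix.trans ?_ hinf))
      exact ⟨[shuffle n p], [P], by simp⟩
    · rw [size_cat hne]
      have := size_pos P
      omega

theorem uniqueBelow_of_tightUpTo {N : ℕ} (hB : TightUpTo N) (K : ℕ) : UniqueBelow N K := by
  induction K with
  | zero => exact fun _ _ _ _ _ _ h => absurd h (Nat.not_lt_zero _)
  | succ K hU =>
    intro s t hs ht hsr htr hK ⟨e⟩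
    have h := IsGood.forall₂_orderIso (fun a => mem_atoms) (fun a => mem_atoms)
      (hU.isGood_atoms hB hs hsr (by omega)) (hU.isGood_atoms hB ht htr (by omega))
      (((atoms_orderIso s).some.symm.trans e).trans (atoms_orderIso t).some)
    have h' : List.Forall₂ Same s.atoms t.atoms := by
      rw [List.forall₂_iff_get] at h ⊢
      refine ⟨h.1, fun i hi hi' => ?_⟩
      have ha : s.atoms.get ⟨i, hi⟩ ∈ s.atoms := List.get_mem _ _
      have hb : t.atoms.get ⟨i, hi'⟩ ∈ t.atoms := List.get_mem _ _
      refine hU.same_atoms hB (mem_atoms ha) (mem_atoms hb) (hs.of_mem_atoms ha)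
        (ht.of_mem_atoms hb) ((rank_le_of_mem_atoms ha).trans hsr)
        ((rank_le_of_mem_atoms hb).trans htr) ?_ (h.2 i hi hi')
      have := size_le_of_mem_atoms ha
      have := size_le_of_mem_atoms hb
      omega
    exact ((same_cat_atoms s).symm.trans (same_cat_of_forall₂ h')).trans (same_cat_atoms t)

/-- For `isNormal_flank`: a block lies within one side, where absorption is already excluded, or
contains the central entry `c`. -/
theorem infix_append_cons {α : Type*} {l X Y : List α} {c : α} (h : l <:+: X ++ c :: Y) :
    l <:+: X ∨ l <:+: Y ∨ ∃ x y, l = x ++ c :: y ∧ x ⊆ X ∧ y ⊆ Y := by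
  obtain ⟨s, t, h⟩ := h
  rcases List.append_eq_append_iff.1 h with ⟨w, rfl, -⟩ | ⟨w, hw, hw'⟩
  · exact Or.inl ⟨s, w, rfl⟩
  · cases w with
    | nil => exact Or.inl ⟨s, [], by simpa using hw⟩
    | cons d w =>
      obtain ⟨rfl, rfl⟩ := List.cons.inj hw'
      rcases List.append_eq_append_iff.1 hw with ⟨v, rfl, rfl⟩ | ⟨v, rfl, hv⟩
      · exact Or.inr (Or.inr ⟨v, w, rfl, List.subset_append_right _ _,
          List.subset_append_left _ _⟩)
      · cases v with
        | nil => exact Or.inr (Or.inr ⟨[], w, hv.symm, List.nil_subset _,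
            List.subset_append_left _ _⟩)
        | cons d v =>
          obtain ⟨-, rfl⟩ := List.cons.inj hv
          exact Or.inr (Or.inl ⟨v, t, rfl⟩)

theorem flank_orderIso {m : ℕ} (q : Fin (m + 1) → OTerm) (o₀ o₁ : Option (Fin (m + 1))) :
    Nonempty (Shuffle.Flank (fun i => (q i).toLinOrd) o₀ o₁ ≃o
      (cat ((o₀.map q).toList ++ [shuffle m q] ++ (o₁.map q).toList)).toLinOrd) := by
  have : IsEmpty (OptOrd (fun i => (q i).toLinOrd) none) := inferInstanceAs (IsEmpty Empty)
  rcases o₀ with _ | i <;> rcases o₁ with _ | j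
  · exact ⟨OrderIso.sumLexEmpty.trans OrderIso.emptySumLex⟩
  · exact ⟨OrderIso.emptySumLex.sumLexCongr (OrderIso.refl _)⟩
  · exact ⟨OrderIso.sumLexEmpty⟩
  · exact ⟨OrderIso.refl _⟩

/-- A tight normal shuffle with optional arguments on either side is normal. -/
theorem isNormal_flank {m : ℕ} {q : Fin (m + 1) → OTerm} (hq : (shuffle m q).IsNormal)
    (ht : Tight q) (o₀ o₁ : Option (Fin (m + 1))) :
    (cat ((o₀.map q).toList ++ [shuffle m q] ++ (o₁.map q).toList)).IsNormal := by
  have hmem : ∀ o : Option (Fin (m + 1)), ∀ a ∈ (o.map q).toList.flatMap atoms,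
      ∃ j, a ∈ (q j).atoms := by
    rintro (_ | j) a ha
    · simp at ha
    · exact ⟨j, by simpa using ha⟩
  have hinf : ∀ (o : Option (Fin (m + 1))) (l : List OTerm),
      l <:+: (o.map q).toList.flatMap atoms → ¬ IsAbsorbing l := by
    rintro (_ | j) l hl
    · exact fun h => absurd (h.two_le_length.trans hl.length_le) (by simp)
    · exact (hq.1 j).not_isAbsorbing (by simpa using hl)
  refine isNormal_cat (fun a ha => ?_) fun l hl => ?_
  · rcases List.mem_append.1 ha with ha | ha
    · rcases List.mem_append.1 ha with ha | ha
      · rcases o₀ with _ | j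
        · simp at ha
        · obtain rfl : a = q j := by simpa using ha
          exact hq.1 j
      · rwa [List.mem_singleton.1 ha]
    · rcases o₁ with _ | j
      · simp at ha
      · obtain rfl : a = q j := by simpa using ha
        exact hq.1 j
  · rw [List.append_assoc, List.flatMap_append, List.flatMap_append] at hl
    rcases infix_append_cons (c := shuffle m q) hl with h | h | ⟨x, y, rfl, hx, hy⟩
    · exact hinf _ _ h
    · exact hinf _ _ h
    -- If the shuffle of `q` is the first entry of the absorbing block, the last entry is a copy of
    -- it among the atoms of some `q j`. Otherwise the first entry is an atom of some `q j`, and the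
    -- shuffle of `q` embeds in it, being the last entry or part of an argument `p i`. Both
    -- contradict tightness.
    · rintro ⟨n, p, μ, P, hxy, hP, hμ⟩
      cases x with
      | nil =>
        obtain ⟨h1, rfl⟩ := List.cons.inj hxy
        obtain ⟨j, hj⟩ := hmem _ P (hy (by simp))
        rw [← h1] at hP
        exact ht j ((convexEmb_of_mem_atoms hj).congr_left hP.orderIso.some.symm)
      | cons a x =>
        obtain ⟨rfl, h1⟩ := List.cons.inj hxy
        obtain ⟨j, hj⟩ := hmem _ _ (hx List.mem_cons_self)
        have hj' := convexEmb_of_mem_atoms hj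
        have hc : shuffle m q ∈ μ ++ [P] := by rw [← h1]; simp
        rcases List.mem_append.1 hc with hc | hc
        · rcases hμ with rfl | ⟨i, hi⟩
          · simp at hc
          · obtain ⟨-, hi⟩ := isConcat_iff.1 hi
            exact ht j ((((convexEmb_cat_of_mem hc).congr_right hi.orderIso.some).trans
              (convexEmb_shuffle p i)).trans hj')
        · rw [← List.mem_singleton.1 hc] at hP
          exact ht j (hj'.congr_left hP.orderIso.some)

theorem tightUpTo_succ {N : ℕ} (hB : TightUpTo N) : TightUpTo (N + 1) := by
  have hU : ∀ s t : OTerm, s.IsNormal → t.IsNormal → s.rank ≤ N → t.rank ≤ N →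
      Nonempty (s.toLinOrd ≃o t.toLinOrd) → Same s t := fun s t hs ht hsr htr =>
    uniqueBelow_of_tightUpTo hB (s.size + t.size + 1) s t hs ht hsr htr (Nat.lt_succ_self _)
  intro n p hp hr i₀ h₀
  have hpr : ∀ i, (p i).rank ≤ N := fun i => Nat.le_of_lt_succ ((rank_lt p i).trans_le hr)
  -- The copy of the shuffle inside `p i₀` has a copy in a single atom, which is infinite and so a
  -- shuffle.
  obtain ⟨m, q, hmem, hsub⟩ : ∃ m q, shuffle m q ∈ (p i₀).atoms ∧
      ConvexEmb (shuffle n p).toLinOrd (shuffle m q).toLinOrd := by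
    obtain ⟨l, hl⟩ := exists_convexEmb_inter_fibre (A := fun i => (p i).toLinOrd)
      ((h₀.congr_right (atoms_orderIso (p i₀)).some).congr_right OrderIso.Set.univ.symm)
    rw [univ_inter] at hl
    obtain ⟨a, ha⟩ : ∃ a, (p i₀).atoms[l]? = some a := by
      obtain ⟨f, -⟩ := hl
      obtain ⟨x, hx⟩ := f (Classical.arbitrary (shuffle n p).toLinOrd)
      obtain rfl : lexFst x = l := hx
      exact exists_some x
    have hla := hl.congr_right (optOrd_fibre (T := fun i => (p i₀).atoms[i]?) ha).some.symm
    have ha' := List.mem_of_getElem? ha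
    rcases mem_atoms ha' with rfl | ⟨m, q, rfl⟩
    · obtain ⟨f, -⟩ := hla
      have : Finite one.toLinOrd := isFinite_one
      exact absurd (Finite.of_injective f f.injective) (not_isFinite_shuffle p)
    · exact ⟨m, q, ha', hla⟩
  have hqr : (shuffle m q).rank ≤ N := (rank_le_of_mem_atoms hmem).trans (hpr i₀)
  have hqn : (shuffle m q).IsNormal := (hp.1 i₀).of_mem_atoms hmem
  have hq : Tight q := hB m q hqn hqr
  have hqr' : ∀ j, (q j).rank ≤ N := fun j => (rank_lt q j).le.trans hqr
  obtain ⟨e⟩ := hq.of_convexEmb hsub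
    ((convexEmb_of_mem_atoms hmem).trans (convexEmb_shuffle p i₀))
  have hcases : ∀ i, (∃ j, Nonempty ((p i).toLinOrd ≃o (q j).toLinOrd)) ∨ IsFlanked q (p i) := by
    intro i
    refine (Shuffle.block_cases (A := fun i => (p i).toLinOrd) (B := fun i => (q i).toLinOrd)
      e hq i).imp_right ?_
    rintro ⟨o₀, o₁, ⟨φ⟩⟩
    refine ⟨o₀, o₁, isConcat_iff.2 ⟨by simp, ?_⟩⟩
    -- The flanked term is normal of rank at most `N`, so uniqueness turns the isomorphism into
    -- `Same`.
    refine hU _ _ (isNormal_flank hqn hq o₀ o₁) (hp.1 i) (rank_cat_le fun a ha => ?_) (hpr i)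
      ⟨(φ.trans (flank_orderIso q o₀ o₁).some).symm⟩
    rcases List.mem_append.1 ha with ha | ha
    · rcases List.mem_append.1 ha with ha | ha
      · rcases o₀ with _ | j
        · simp at ha
        · obtain rfl : a = q j := by simpa using ha
          exact hqr' j
      · rwa [List.mem_singleton.1 ha]
    · rcases o₁ with _ | j
      · simp at ha
      · obtain rfl : a = q j := by simpa using ha
        exact hqr' j
  refine hp.2.2 ⟨m, q, ⟨i₀, (hcases i₀).resolve_left ?_⟩, fun i => ?_⟩
  -- The argument `i₀` is of the flanked kind: `p i₀` contains a copy of the shuffle of `q`, and no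
  -- `q j` does.
  · rintro ⟨j, ⟨φ⟩⟩
    exact hq j ((h₀.congr_left e).congr_right φ)
  · exact (hcases i).symm.imp_right fun ⟨j, hj⟩ => ⟨j, hU _ _ (hp.1 i) (hqn.1 j) (hpr i) (hqr' j) hj⟩

theorem tightUpTo (N : ℕ) : TightUpTo N := by
  induction N with
  | zero => exact fun n p _ h => absurd h (Nat.not_succ_le_zero _)
  | succ N ih => exact tightUpTo_succ ih

theorem IsNormal.tight {n : ℕ} {p : Fin (n + 1) → OTerm} (h : (shuffle n p).IsNormal) : Tight p :=
  tightUpTo _ n p h le_rfl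

/-- Normal terms that represent isomorphic linear orders are the same. -/
theorem IsNormal.same {s t : OTerm} (hs : s.IsNormal) (ht : t.IsNormal)
    (h : Nonempty (s.toLinOrd ≃o t.toLinOrd)) : Same s t :=
  uniqueBelow_of_tightUpTo (tightUpTo (max s.rank t.rank)) _ s t hs ht (le_max_left _ _)
    (le_max_right _ _) (Nat.lt_succ_self _) h

/-! ### Sequences of finite terms and shuffles -/

theorem IsFinite.mem_atoms {t a : OTerm} (ht : t.IsFinite) (h : a ∈ t.atoms) : a = one := by
  rcases OTerm.mem_atoms h with rfl | ⟨n, p, rfl⟩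
  · rfl
  · obtain ⟨f, -⟩ := convexEmb_of_mem_atoms h
    have : Finite t.toLinOrd := ht
    exact absurd (Finite.of_injective f f.injective) (not_isFinite_shuffle p)

/-- A shuffle among the components of a list of finite terms and shuffles is an entry of it. -/
theorem exists_split_of_flatMap_atoms {l u v : List OTerm} {n : ℕ} {p : Fin (n + 1) → OTerm}
    (hl : ∀ a ∈ l, a.IsFinite ∨ a.IsShuffle) (h : l.flatMap atoms = u ++ shuffle n p :: v) :
    ∃ u' v', l = u' ++ shuffle n p :: v' ∧ u = u'.flatMap atoms ∧ v = v'.flatMap atoms := by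
  induction l generalizing u with
  | nil => simp at h
  | cons a l ih =>
    rw [List.flatMap_cons, List.append_eq_append_iff] at h
    have hl' : ∀ b ∈ l, b.IsFinite ∨ b.IsShuffle := fun b hb => hl b (List.mem_cons_of_mem _ hb)
    rcases h with ⟨w, rfl, hw⟩ | ⟨w, hw, hw'⟩
    · obtain ⟨u', v', rfl, rfl, rfl⟩ := ih hl' hw
      exact ⟨a :: u', v', rfl, by simp, rfl⟩
    · cases w with
      | nil =>
        obtain ⟨u', v', rfl, hu, rfl⟩ := ih (u := []) hl' hw'.symm
        refine ⟨a :: u', v', rfl, ?_, rfl⟩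
        rw [List.flatMap_cons, ← hu, hw]
        simp
      | cons b w =>
        obtain ⟨rfl, rfl⟩ := List.cons.inj hw'
        have hmem : shuffle n p ∈ a.atoms := by rw [hw]; simp
        rcases hl a List.mem_cons_self with hf | ⟨m, q, rfl⟩
        · cases hf.mem_atoms hmem
        · simp only [atoms] at hw
          rcases u with _ | ⟨c, u⟩
          · simp only [List.nil_append, List.cons.injEq] at hw
            obtain ⟨h1, rfl⟩ := hw
            exact ⟨[], l, by rw [h1]; rfl, rfl, rfl⟩
          · simp at hw

/-- A list of finite terms and shuffles is normal if no block of entries is absorbing. -/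
theorem isNormal_cat_of_component {l : List OTerm} (hl : ∀ a ∈ l, a.IsFinite ∨ a.IsShuffle)
    (hn : ∀ a ∈ l, a.IsNormal) (h : ∀ m, m <:+: l → ¬ IsAbsorbing m) : (cat l).IsNormal := by
  refine isNormal_cat hn fun m hm => ?_
  rintro ⟨n, p, μ, P, rfl, hP, hμ⟩
  obtain ⟨u, v, huv⟩ := hm
  -- Shuffles among the atoms are whole entries of `l`, so an absorbing block of atoms begins and
  -- ends at entries and comes from a block of `l`.
  obtain ⟨u', v', rfl, -, hv⟩ := exists_split_of_flatMap_atoms (u := u) (n := n) (p := p)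
    (v := μ ++ [P] ++ v) hl (by rw [← huv]; simp)
  have hl' : ∀ a ∈ v', a.IsFinite ∨ a.IsShuffle := fun a ha => hl a (by simp [ha])
  obtain ⟨m, r, rfl⟩ : P.IsShuffle := by
    have hPmem : P ∈ v'.flatMap atoms := by rw [← hv]; simp
    obtain ⟨a, -, ha⟩ := List.mem_flatMap.1 hPmem
    rcases mem_atoms ha with rfl | h
    · exact absurd ⟨hP.orderIso.some.symm⟩ not_orderIso_one
    · exact h
  obtain ⟨w, v'', rfl, rfl, -⟩ := exists_split_of_flatMap_atoms (u := μ) (n := m) (p := r)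
    (v := v) hl' (by rw [← hv]; simp)
  refine h (shuffle n p :: (w ++ [shuffle m r])) ⟨u', v'', by simp⟩
    ⟨n, p, w, _, rfl, hP, ?_⟩
  rcases eq_or_ne w [] with hw | hw
  · exact Or.inl hw
  · rcases hμ with hμ | ⟨i, hi⟩
    · obtain ⟨a, ha⟩ := List.exists_mem_of_ne_nil w hw
      have := List.flatMap_eq_nil_iff.1 hμ a ha
      exact absurd this a.atoms_ne_nil
    · obtain ⟨-, hi⟩ := isConcat_iff.1 hi
      rw [← atoms_cat hw] at hi
      exact Or.inr ⟨i, isConcat_iff.2 ⟨hw, (same_cat_atoms _).symm.trans hi⟩⟩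

end OTerm

/-! ### From `TermSeq` to sequences of optional terms, and the proposition -/

namespace TermSeq

open OTerm

/-- The entries of a sequence of terms, `none` beyond its end. -/
noncomputable def entry (T : TermSeq) (i : ℕ) : Option OTerm :=
  open Classical in if h : (i : ℕ∞) < T.length then some (T.term ⟨i, h⟩) else none

theorem entry_of_lt {T : TermSeq} {i : ℕ} (h : (i : ℕ∞) < T.length) :
    T.entry i = some (T.term ⟨i, h⟩) := dif_pos h

theorem entry_eq_none_iff {T : TermSeq} {i : ℕ} : T.entry i = none ↔ ¬ (i : ℕ∞) < T.length := by
  unfold entry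
  split_ifs with h <;> simp [h]

theorem entry_eq_some_iff {T : TermSeq} {i : ℕ} {a : OTerm} :
    T.entry i = some a ↔ ∃ h : (i : ℕ∞) < T.length, T.term ⟨i, h⟩ = a := by
  unfold entry
  split_ifs with h <;> simp [h]

theorem order_orderIso (T : TermSeq) : Nonempty (T.order ≃o seqOrd T.entry) := by
  have hfib : ∀ i : {i : ℕ // (i : ℕ∞) < T.length},
      Nonempty ((T.term i).toLinOrd ≃o (lexFst ⁻¹' {(i : ℕ)} : Set (seqOrd T.entry))) := fun i =>
    optOrd_fibre (entry_of_lt i.2)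
  let g : seqOrd T.entry → {i : ℕ // (i : ℕ∞) < T.length} := fun x =>
    ⟨lexFst x, (entry_eq_some_iff.1 (exists_some x).choose_spec).1⟩
  refine orderIso_of_fibres (f := lexFst) (g := g) lexFst_monotone
    (fun x y h => lexFst_monotone (A := fun i => optOrd (T.entry i)) h) (OrderIso.refl _)
    fun i => ?_
  obtain ⟨φ⟩ := lexFst_fibre (A := fun i => (T.term i).toLinOrd) i
  obtain ⟨ψ⟩ := hfib i
  have : (g ⁻¹' {i} : Set (seqOrd T.entry)) = lexFst ⁻¹' {(i : ℕ)} := by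
    ext x
    exact Subtype.ext_iff
  exact ⟨(φ.symm.trans ψ).trans (orderIso_setCongr this.symm).some⟩

theorem isSegment_of_segment {T : TermSeq} {i : ℕ} {l : List OTerm} (h : Segment T.entry i l) :
    T.IsSegment i l := fun k hk => entry_eq_some_iff.1 (h k hk)

theorem exists_segment_of_infix {T : ℕ → Option OTerm} {i : ℕ} {l m : List OTerm} (h : Segment T i l)
    (hm : m <:+: l) : ∃ j, Segment T j m := by
  obtain ⟨u, v, rfl⟩ := hm
  exact ⟨_, h.left.right⟩

/-- Normal shuffles are tight, and isomorphic normal terms are the same, so a segment that is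
absorbing up to isomorphism is absorbing. -/
theorem IsNormal.isReduced {T : TermSeq} (hT : T.IsNormal) : IsReduced T.entry where
  none_succ i hi := by
    rw [entry_eq_none_iff] at hi ⊢
    exact fun h => hi (lt_of_le_of_lt (by exact_mod_cast Nat.le_succ i) h)
  component i t ht := by
    obtain ⟨h, rfl⟩ := entry_eq_some_iff.1 ht
    refine (hT.component ⟨i, h⟩).imp_right ?_
    rintro ⟨n, p, hp⟩
    exact ⟨n, p, hp, (hp ▸ hT.normal ⟨i, h⟩ : (OTerm.shuffle n p).IsNormal).tight⟩
  not_absorbing i n p m P hseg e hm := by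
    have hmem : ∀ b ∈ OTerm.shuffle n p :: (m ++ [P]), (b.IsFinite ∨ b.IsShuffle) ∧ b.IsNormal := by
      intro b hb
      obtain ⟨k, hk, rfl⟩ := List.getElem_of_mem hb
      obtain ⟨h, h'⟩ := entry_eq_some_iff.1 (hseg k hk)
      rw [← h']
      exact ⟨hT.component _, hT.normal _⟩
    have ha := (hmem _ List.mem_cons_self).2
    refine hT.not_absorbing i _ (isSegment_of_segment hseg)
      ⟨n, p, m, P, rfl, ha.same (hmem P (by simp)).2 e, hm.imp_right ?_⟩
    rintro ⟨hne, j, hj⟩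
    refine ⟨j, isConcat_iff.2 ⟨hne, OTerm.IsNormal.same (isNormal_cat_of_component
      (fun b hb => (hmem b (by simp [hb])).1) (fun b hb => (hmem b (by simp [hb])).2)
      fun l hl => ?_) (ha.1 j) hj⟩⟩
    obtain ⟨k, hk⟩ := exists_segment_of_infix hseg (hl.trans ⟨[OTerm.shuffle n p], [P], by simp⟩)
    exact hT.not_absorbing k l (isSegment_of_segment hk)
  finite_next i a b ha hb hf := by
    obtain ⟨h, rfl⟩ := entry_eq_some_iff.1 ha
    obtain ⟨h', rfl⟩ := entry_eq_some_iff.1 hb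
    refine (hT.finite_next i h h' hf).imp_right ?_
    rintro ⟨htop, hone⟩ k hk
    exact entry_eq_some_iff.2 ⟨htop ▸ ENat.natCast_lt_top k, hone k _ hk⟩

end TermSeq

theorem mainTheorem2 (T S : TermSeq) (hT : T.IsNormal) (hS : S.IsNormal)
    (h : Nonempty (T.order ≃o S.order)) :
    T.length = S.length ∧
      ∀ (j : ℕ) (hjT : (j : ℕ∞) < T.length) (hjS : (j : ℕ∞) < S.length),
        OTerm.Same (T.term ⟨j, hjT⟩) (S.term ⟨j, hjS⟩) := by
  have key := hT.isReduced.unique hS.isReduced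
    ((T.order_orderIso.some.symm.trans h.some).trans S.order_orderIso.some)
  refine ⟨?_, fun j hjT hjS => (hT.normal _).same (hS.normal _)
    ((key j).2 _ _ (TermSeq.entry_of_lt hjT) (TermSeq.entry_of_lt hjS))⟩
  have hlt : ∀ j : ℕ, (j : ℕ∞) < T.length ↔ (j : ℕ∞) < S.length := fun j => by
    rw [← not_iff_not, ← TermSeq.entry_eq_none_iff, ← TermSeq.entry_eq_none_iff]
    exact (key j).1
  -- An element of `ℕ∞` is determined by the natural numbers below it.
  have hle : ∀ {m n : ℕ∞}, (∀ j : ℕ, (j : ℕ∞) < m → (j : ℕ∞) < n) → m ≤ n := fun {m n} h => by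
    by_contra hlt
    obtain ⟨k, rfl⟩ := ENat.ne_top_iff_exists.1 (ne_top_of_lt (not_le.1 hlt))
    exact lt_irrefl _ (h k (not_le.1 hlt))
  exact le_antisymm (hle fun j => (hlt j).1) (hle fun j => (hlt j).2)
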